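/- All graphs are finite and simple. For a graph $G$ let $\lambda(G)$ denote its spectral radius, i.e. the largest absolute value of an eigenvalue of its adjacency matrix, and let $t(G)$ denote its number of triangles. Let $T_{n,2}=K_{\lceil n/2\rceil,\lfloor n/2\rfloor}$ be the balanced complete bipartite graph on $n$ vertices. Let $K_{a,b}^{+}$ be the graph obtained from the complete bipartite graph $K_{a,b}$ by adding one edge $e_1$ inside the part of size $a$, and let $K_{a,b}^{+|}$ be the graph obtained from $K_{a,b}^{+}$ by deleting one edge between the two parts that is incident to $e_1$. Graphs are considered up to isomorphism. **Theorem.** Let $n\ge 36$ and let $G$ be a graph on $n$ vertices. (a) If $\lambda(G)\ge\lambda(T_{n,2})$ and $G\ne T_{n,2}$, then $t(G)\ge\lfloor n/2\rfloor-1$. (b) The following three conditions are equivalent: 1. $\lambda(G)\ge\lambda(T_{n,2})$, $G\ne T_{n,2}$ and $t(G)=\lfloor n/2\rfloor-1$; 2. $\lambda(G)>\lambda(T_{n,2})$ and $t(G)=\lfloor n/2\rfloor-1$; 3. $G\in\{K_{\frac n2+1,\frac n2-1}^{+},\,K_{\frac n2,\frac n2}^{+|}\}$ if $n$ is even, and $G=K_{\frac{n+1}2,\frac{n-1}2}^{+|}$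 if $n$ is odd. -/

import Mathlib

open scoped ENNReal

/-- The spectral radius of a finite graph: the largest absolute value of an eigenvalue of its
adjacency matrix. The matrix is real symmetric, so all its complex eigenvalues are real. -/
noncomputable def adjSpectralRadius {V : Type*} [Fintype V] [DecidableEq V]
    (G : SimpleGraph V) [DecidableRel G.Adj] : ℝ≥0∞ :=
  spectralRadius ℝ (G.adjMatrix ℝ)

/-- The number of triangles of a finite graph. -/
def triangleCount {V : Type*} [Fintype V] [DecidableEq V]
    (G : SimpleGraph V) [DecidableRel G.Adj] : ℕ :=
  (G.cliqueFinset 3).card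

/-- `K_{a,b}^+` (for `2 ≤ a`): the complete bipartite graph `K_{a,b}` together with one edge
between two vertices, numbered `0` and `1`, of the part of size `a`. -/
def bipartitePlus (a b : ℕ) : SimpleGraph (Fin a ⊕ Fin b) :=
  completeBipartiteGraph (Fin a) (Fin b) ⊔
    SimpleGraph.fromRel fun x y =>
      ∃ i j : Fin a, i.val = 0 ∧ j.val = 1 ∧ x = Sum.inl i ∧ y = Sum.inl j

/-- `K_{a,b}^{+|}` (for `2 ≤ a` and `1 ≤ b`): the graph `K_{a,b}^+` without one edge between the
two parts that is incident to the added edge. -/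
def bipartitePlusMinus (a b : ℕ) : SimpleGraph (Fin a ⊕ Fin b) :=
  (bipartitePlus a b).deleteEdges
    {e | ∃ (i : Fin a) (j : Fin b), i.val = 0 ∧ j.val = 0 ∧ e = s(Sum.inl i, Sum.inr j)}

/-- `G` is, up to isomorphism, `K_{n/2+1,n/2-1}^+` or `K_{n/2,n/2}^{+|}` when `n` is even, and
`K_{(n+1)/2,(n-1)/2}^{+|}` when `n` is odd. -/
def IsTriangleExtremal {V : Type*} (n : ℕ) (G : SimpleGraph V) : Prop :=
  (Even n ∧ (Nonempty (G ≃g bipartitePlus (n / 2 + 1) (n / 2 - 1)) ∨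
    Nonempty (G ≃g bipartitePlusMinus (n / 2) (n / 2)))) ∨
  (Odd n ∧ Nonempty (G ≃g bipartitePlusMinus ((n + 1) / 2) ((n - 1) / 2)))

section

open Finset Matrix

/-! Write h = ⌊n/2⌋, so that λ(T_{n,2})² = h(n - h), and let G have m edges, t ≤ h - 1 triangles and
spectral radius l ≥ λ(T_{n,2}). The core is that such a G, unless it is T_{n,2}, is one of the
extremal graphs; as these have exactly h - 1 triangles, (a) and the forward halves of (b) follow at
once.

Many edges: the trace inequality l³ ≤ l m + 3t (`pow_three_le_of_perron`) together with t < h ≤ l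
gives m ≥ h(n - h) - 2.

Nearly bipartite: averaging over edges yields an edge uv such that every vertex is adjacent to
exactly one of u, v, and few triangles meet u or v (`exists_separating_edge`). The two
neighbourhoods partition the vertices, and the edges inside them are the edges opposite u or v in
triangles. With s edges inside the parts, nearly all cross edges are present, so each inside edge
lies in about h triangles; this forces s ≤ 1 (`exists_partition`).

If s = 0, then t = 0, hence m ≥ l² ≥ h(n - h), and G is T_{n,2}. If s = 1, let a, b be the part
sizes and q the number of missing cross edges. The eigenvector equations give roughly l² - ab ≤ 2 -
2q (`perron_bound`). Since h(n - h) - ab is a nonnegative integer and the inside edge may lie in at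
most h - 1 triangles, only the extremal graphs survive (`isTriangleExtremal_of_one_inside_edge`).

Conversely, in an extremal graph all triangles contain the inside edge, and explicit test vectors in
the Rayleigh quotient show λ > λ(T_{n,2}). -/

/-! ### Perron vectors and the trace inequality. -/

theorem posSemidef_smul_one_sub_of_eigenvalues_le {V : Type*} [Fintype V] [DecidableEq V]
    {A : Matrix V V ℝ} (hA : A.IsHermitian) {l : ℝ} (h : ∀ i, hA.eigenvalues i ≤ l) :
    (l • (1 : Matrix V V ℝ) - A).PosSemidef := by
  rw [posSemidef_iff_isHermitian_and_spectrum_nonneg]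
  refine ⟨(isHermitian_one.smul (IsSelfAdjoint.all l)).sub hA, ?_⟩
  rw [← Algebra.algebraMap_eq_smul_one, ← spectrum.singleton_sub_eq,
    hA.spectrum_real_eq_range_eigenvalues]
  rintro _ ⟨_, rfl, _, ⟨i, rfl⟩, rfl⟩
  exact sub_nonneg.2 (h i)

theorem posSemidef_smul_one_add_of_le_eigenvalues {V : Type*} [Fintype V] [DecidableEq V]
    {A : Matrix V V ℝ} (hA : A.IsHermitian) {l : ℝ} (h : ∀ i, -l ≤ hA.eigenvalues i) :
    (l • (1 : Matrix V V ℝ) + A).PosSemidef := by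
  rw [posSemidef_iff_isHermitian_and_spectrum_nonneg]
  refine ⟨(isHermitian_one.smul (IsSelfAdjoint.all l)).add hA, ?_⟩
  rw [← Algebra.algebraMap_eq_smul_one, ← spectrum.singleton_add_eq,
    hA.spectrum_real_eq_range_eigenvalues]
  rintro _ ⟨_, rfl, _, ⟨i, rfl⟩, rfl⟩
  exact neg_le_iff_add_nonneg'.1 (h i)

theorem adjMatrix_nonneg {V : Type*} (G : SimpleGraph V) [DecidableRel G.Adj] (i j : V) :
    0 ≤ G.adjMatrix ℝ i j := by
  rw [SimpleGraph.adjMatrix_apply]; split_ifs <;> norm_num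

/-- The spectral radius of a graph is an eigenvalue with a nonnegative eigenvector, and it bounds
the quadratic form of the adjacency matrix on both sides. -/
theorem exists_perron_vector {V : Type*} [Fintype V] [DecidableEq V] [Nonempty V]
    (G : SimpleGraph V) [DecidableRel G.Adj] :
    ∃ (l : ℝ) (v : V → ℝ), 0 ≤ l ∧ adjSpectralRadius G = ENNReal.ofReal l ∧ v ≠ 0 ∧
      (∀ i, 0 ≤ v i) ∧ G.adjMatrix ℝ *ᵥ v = l • v ∧
      (l • (1 : Matrix V V ℝ) - G.adjMatrix ℝ).PosSemidef ∧
      (l • (1 : Matrix V V ℝ) + G.adjMatrix ℝ).PosSemidef := by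
  have hA : (G.adjMatrix ℝ).IsHermitian := G.isHermitian_adjMatrix ℝ
  obtain ⟨k, hk⟩ := Finite.exists_max fun i => |hA.eigenvalues i|
  set l := |hA.eigenvalues k| with hl
  have hsub := posSemidef_smul_one_sub_of_eigenvalues_le hA (l := l)
    fun i => (le_abs_self _).trans (hk i)
  have hadd := posSemidef_smul_one_add_of_le_eigenvalues hA (l := l)
    fun i => neg_le_of_abs_le (hk i)
  set x : V → ℝ := ⇑(hA.eigenvectorBasis k) with hx
  have hxe : G.adjMatrix ℝ *ᵥ x = hA.eigenvalues k • x := hA.mulVec_eigenvectorBasis k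
  have hx0 : x ≠ 0 := by
    intro h
    have := hA.eigenvectorBasis.toBasis.ne_zero k
    apply this
    ext i
    simpa using congrFun h i
  refine ⟨l, fun i => |x i|, abs_nonneg _, ?_, ?_, fun i => abs_nonneg _, ?_, hsub, hadd⟩
  · unfold adjSpectralRadius spectralRadius
    apply le_antisymm
    · refine iSup₂_le fun r hr => ?_
      rw [hA.spectrum_real_eq_range_eigenvalues] at hr
      obtain ⟨i, rfl⟩ := hr
      rw [← enorm_eq_nnnorm, ← ofReal_norm, Real.norm_eq_abs]
      exact ENNReal.ofReal_le_ofReal (hk i)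
    · refine le_trans ?_ (le_iSup₂ (hA.eigenvalues k) (hA.eigenvalues_mem_spectrum_real k))
      rw [← enorm_eq_nnnorm, ← ofReal_norm, Real.norm_eq_abs]
  · intro h
    apply hx0
    funext i
    simpa using congrFun h i
  -- Taking absolute values does not decrease the absolute value of the quadratic form, so |x|
  -- attains the maximum l of the Rayleigh quotient and lies in the kernel of the positive
  -- semidefinite matrix l - A.
  · have h0 : star (fun i => |x i|) ⬝ᵥ
        ((l • (1 : Matrix V V ℝ) - G.adjMatrix ℝ) *ᵥ fun i => |x i|) = 0 := by
      apply le_antisymm _ (hsub.dotProduct_mulVec_nonneg _)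
      have h1 : |x ⬝ᵥ (G.adjMatrix ℝ *ᵥ x)| ≤
          (fun i => |x i|) ⬝ᵥ (G.adjMatrix ℝ *ᵥ fun i => |x i|) := by
        simp only [dotProduct, mulVec]
        refine (abs_sum_le_sum_abs _ _).trans (sum_le_sum fun i _ => ?_)
        rw [abs_mul]
        refine mul_le_mul_of_nonneg_left ?_ (abs_nonneg _)
        refine (abs_sum_le_sum_abs _ _).trans (sum_le_sum fun j _ => ?_)
        rw [abs_mul, abs_of_nonneg (adjMatrix_nonneg G i j)]
      have h2 : x ⬝ᵥ x = (fun i => |x i|) ⬝ᵥ (fun i => |x i|) := by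
        simp [dotProduct]
      rw [hxe, dotProduct_smul, smul_eq_mul, abs_mul, ← hl, abs_of_nonneg (by
        rw [h2]; exact sum_nonneg fun i _ => mul_self_nonneg _), h2] at h1
      simp only [star_trivial, sub_mulVec, smul_mulVec, one_mulVec, dotProduct_sub,
        dotProduct_smul, smul_eq_mul]
      linarith
    have h3 := (hsub.dotProduct_mulVec_zero_iff _).1 h0
    simp only [sub_mulVec, smul_mulVec, one_mulVec] at h3
    exact (sub_eq_zero.1 h3).symm

theorem le_trace_of_posSemidef {V : Type*} [Fintype V] [DecidableEq V] {N : Matrix V V ℝ}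
    (hN : N.PosSemidef) {k : ℝ} {v : V → ℝ} (hv : v ≠ 0) (h : N *ᵥ v = k • v) :
    k ≤ N.trace := by
  have hk : k ∈ spectrum ℝ N := by
    rw [← spectrum_toLin', ← Module.End.hasEigenvalue_iff_mem_spectrum]
    exact Module.End.hasEigenvalue_of_hasEigenvector (x := v)
      ⟨Module.End.mem_eigenspace_iff.2 (by simpa using h), hv⟩
  rw [hN.isHermitian.spectrum_real_eq_range_eigenvalues] at hk
  obtain ⟨i, rfl⟩ := hk
  have := hN.isHermitian.trace_eq_sum_eigenvalues
  simp only [RCLike.ofReal_real_eq_id, id_eq] at this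
  rw [this]
  exact single_le_sum (fun j _ => hN.eigenvalues_nonneg j) (mem_univ i)

/-- The matrix A(l + A)A is positive semidefinite and has v as an eigenvector with eigenvalue 2l³,
which is at most its trace. For an adjacency matrix the two traces count edges and triangles. -/
theorem two_mul_pow_three_le_trace {V : Type*} [Fintype V] [DecidableEq V] {A : Matrix V V ℝ}
    (hA : A.IsHermitian) {l : ℝ} (hl : (l • (1 : Matrix V V ℝ) + A).PosSemidef) {v : V → ℝ}
    (hv : v ≠ 0) (h : A *ᵥ v = l • v) :
    2 * l ^ 3 ≤ l * (A * A).trace + (A * A * A).trace := by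
  have hN := hl.conjTranspose_mul_mul_same A
  rw [hA.eq] at hN
  have h1 : (A * (l • (1 : Matrix V V ℝ) + A) * A) *ᵥ v = (2 * l ^ 3) • v := by
    rw [← mulVec_mulVec, h, ← mulVec_mulVec, mulVec_smul, add_mulVec, h, smul_mulVec, one_mulVec,
      mulVec_smul, mulVec_add, mulVec_smul, h]
    ext i
    simp only [Pi.smul_apply, Pi.add_apply, smul_eq_mul]
    ring
  have h2 := le_trace_of_posSemidef hN hv h1
  rw [mul_add, add_mul, trace_add, mul_smul_comm, smul_mul_assoc, mul_one, trace_smul,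
    smul_eq_mul] at h2
  exact h2

theorem adjSpectralRadius_iso {V W : Type*} [Fintype V] [DecidableEq V] [Fintype W]
    [DecidableEq W] {G : SimpleGraph V} [DecidableRel G.Adj] {H : SimpleGraph W}
    [DecidableRel H.Adj] (f : G ≃g H) : adjSpectralRadius G = adjSpectralRadius H := by
  unfold adjSpectralRadius spectralRadius
  have : G.adjMatrix ℝ = Matrix.reindexAlgEquiv ℝ ℝ f.symm.toEquiv (H.adjMatrix ℝ) := by
    rw [Matrix.coe_reindexAlgEquiv]
    exact (SimpleGraph.Iso.reindex_adjMatrix ℝ f.symm).symm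
  rw [this, AlgEquiv.spectrum_eq]

theorem triangleCount_iso {V W : Type*} [Fintype V] [DecidableEq V] [Fintype W]
    [DecidableEq W] {G : SimpleGraph V} [DecidableRel G.Adj] {H : SimpleGraph W}
    [DecidableRel H.Adj] (f : G ≃g H) : triangleCount G = triangleCount H := by
  unfold triangleCount
  refine card_bij (fun s _ => s.map f.toEquiv.toEmbedding) ?_ ?_ ?_
  · intro s hs
    rw [SimpleGraph.mem_cliqueFinset_iff, SimpleGraph.is3Clique_iff] at hs ⊢
    obtain ⟨a, b, c, h1, h2, h3, rfl⟩ := hs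
    exact ⟨f a, f b, f c, f.map_adj_iff.2 h1, f.map_adj_iff.2 h2, f.map_adj_iff.2 h3, by simp⟩
  · intro s _ t _ h
    exact map_injective _ h
  · intro s hs
    rw [SimpleGraph.mem_cliqueFinset_iff, SimpleGraph.is3Clique_iff] at hs
    obtain ⟨a, b, c, h1, h2, h3, rfl⟩ := hs
    refine ⟨{f.symm a, f.symm b, f.symm c}, ?_, by simp⟩
    rw [SimpleGraph.mem_cliqueFinset_iff, SimpleGraph.is3Clique_iff]
    exact ⟨_, _, _, f.symm.map_adj_iff.2 h1, f.symm.map_adj_iff.2 h2, f.symm.map_adj_iff.2 h3, rfl⟩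

theorem lt_adjSpectralRadius {V : Type*} [Fintype V] [DecidableEq V] (G : SimpleGraph V)
    [DecidableRel G.Adj] {k : ℝ} (hk : 0 ≤ k) (w : V → ℝ)
    (h : k * (w ⬝ᵥ w) < w ⬝ᵥ (G.adjMatrix ℝ *ᵥ w)) : ENNReal.ofReal k < adjSpectralRadius G := by
  have hV : Nonempty V := by
    by_contra hV
    rw [not_nonempty_iff] at hV
    simp [dotProduct] at h
  obtain ⟨l, v, hl, hr, -, -, -, hs, -⟩ := exists_perron_vector G
  have h1 := hs.dotProduct_mulVec_nonneg w
  simp only [star_trivial, sub_mulVec, smul_mulVec, one_mulVec, dotProduct_sub,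
        dotProduct_smul, smul_eq_mul] at h1
  have h2 : 0 ≤ w ⬝ᵥ w := sum_nonneg fun i _ => mul_self_nonneg _
  rw [hr]
  have h3 : k < l := by
    by_contra! h3
    have := mul_le_mul_of_nonneg_right h3 h2
    linarith
  exact (ENNReal.ofReal_lt_ofReal_iff_of_nonneg hk).2 h3

/-! ### Edges and triangles as sums of matrix entries. -/

theorem trace_adjMatrix_sq {V : Type*} [Fintype V] [DecidableEq V] (G : SimpleGraph V)
    [DecidableRel G.Adj] :
    (G.adjMatrix ℝ * G.adjMatrix ℝ).trace = 2 * (#G.edgeFinset : ℝ) := by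
  simp only [trace, diag_apply, SimpleGraph.adjMatrix_mul_self_apply_self]
  exact_mod_cast G.sum_degrees_eq_twice_card_edges

theorem six_mul_triangleCount {V : Type*} [Fintype V] [DecidableEq V] (G : SimpleGraph V)
    [DecidableRel G.Adj] :
    6 * triangleCount G = #{p : V × V × V | G.Adj p.1 p.2.1 ∧ G.Adj p.1 p.2.2 ∧ G.Adj p.2.1 p.2.2} := by
  rw [triangleCount, mul_comm, ← smul_eq_mul]
  symm
  rw [card_eq_sum_card_fiberwise (f := fun p : V × V × V => ({p.1, p.2.1, p.2.2} : Finset V))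
    (t := G.cliqueFinset 3)]
  · apply sum_const_nat
    intro s hs
    rw [SimpleGraph.mem_cliqueFinset_iff, SimpleGraph.is3Clique_iff] at hs
    obtain ⟨a, b, c, h1, h2, h3, rfl⟩ := hs
    have : (filter (fun p : V × V × V => ({p.1, p.2.1, p.2.2} : Finset V) = {a, b, c})
        {p : V × V × V | G.Adj p.1 p.2.1 ∧ G.Adj p.1 p.2.2 ∧ G.Adj p.2.1 p.2.2}) =
        {(a, b, c), (a, c, b), (b, a, c), (b, c, a), (c, a, b), (c, b, a)} := by
      ext ⟨x, y, z⟩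
      simp only [mem_filter, mem_univ, true_and, mem_insert, mem_singleton, Prod.mk.injEq]
      constructor
      · rintro ⟨⟨e1, e2, e3⟩, h⟩
        have hx : x ∈ ({a, b, c} : Finset V) := h ▸ by simp
        have hy : y ∈ ({a, b, c} : Finset V) := h ▸ by simp
        have hz : z ∈ ({a, b, c} : Finset V) := h ▸ by simp
        have := e1.ne
        have := e2.ne
        have := e3.ne
        simp only [mem_insert, mem_singleton] at hx hy hz
        grind
      · have := h1.symm
        have := h2.symm
        have := h3.symm
        rintro (⟨rfl, rfl, rfl⟩ | ⟨rfl, rfl, rfl⟩ | ⟨rfl, rfl, rfl⟩ | ⟨rfl, rfl, rfl⟩ |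
          ⟨rfl, rfl, rfl⟩ | ⟨rfl, rfl, rfl⟩) <;> refine ⟨by tauto, ?_⟩ <;> ext w <;>
          simp only [mem_insert, mem_singleton] <;> tauto
    rw [this]
    have := h1.ne
    have := h2.ne
    have := h3.ne
    repeat rw [card_insert_of_notMem (by simp only [mem_insert, mem_singleton, Prod.mk.injEq]; grind)]
    simp
  · rintro ⟨x, y, z⟩ h
    simp only [coe_filter, mem_univ, true_and, Set.mem_ofPred_eq] at h
    rw [mem_coe, SimpleGraph.mem_cliqueFinset_iff, SimpleGraph.is3Clique_iff]
    exact ⟨x, y, z, h.1, h.2.1, h.2.2, rfl⟩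

theorem sum_adjMatrix_triangle {V : Type*} [Fintype V] [DecidableEq V] (G : SimpleGraph V)
    [DecidableRel G.Adj] :
    ∑ x, ∑ y, ∑ z, G.adjMatrix ℝ x y * (G.adjMatrix ℝ x z * G.adjMatrix ℝ y z) =
      6 * (triangleCount G : ℝ) := by
  have := six_mul_triangleCount G
  rw [card_filter] at this
  have h := congrArg (Nat.cast : ℕ → ℝ) this
  push_cast at h
  rw [h]
  simp only [Fintype.sum_prod_type, SimpleGraph.adjMatrix_apply]
  refine sum_congr rfl fun x _ => sum_congr rfl fun y _ => sum_congr rfl fun z _ => ?_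
  by_cases h1 : G.Adj x y <;> by_cases h2 : G.Adj x z <;> by_cases h3 : G.Adj y z <;>
    simp [h1, h2, h3]

theorem trace_adjMatrix_pow_three {V : Type*} [Fintype V] [DecidableEq V] (G : SimpleGraph V)
    [DecidableRel G.Adj] :
    (G.adjMatrix ℝ * G.adjMatrix ℝ * G.adjMatrix ℝ).trace = 6 * (triangleCount G : ℝ) := by
  rw [← sum_adjMatrix_triangle, mul_assoc]
  simp only [trace, diag_apply, Matrix.mul_apply, mul_sum]
  refine sum_congr rfl fun x _ => sum_congr rfl fun y _ => sum_congr rfl fun z _ => ?_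
  simp only [SimpleGraph.adjMatrix_apply, G.adj_comm z x]
  ring

/-! ### Averaging: an edge whose two neighbourhoods partition the vertices. -/

theorem averaging_arithmetic {c n m t : ℝ} (hc : 15 ≤ c) (hn : n = 2 * c + 6 ∨ n = 2 * c + 7)
    (hm : n ^ 2 ≤ 4 * m + 9) (ht : t ≤ c + 2) :
    c * (n ^ 2 * m - 4 * m ^ 2 + 6 * t * n) + 3 * n ^ 2 * t < c * n * m := by
  have hn0 : 36 ≤ n := by rcases hn with rfl | rfl <;> linarith
  have h1 : m * (n ^ 2 - 4 * m) ≤ m * 9 :=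
    mul_le_mul_of_nonneg_left (by linarith) (by nlinarith)
  have h2 : n * t * (6 * c + 3 * n) ≤ n * (c + 2) * (6 * c + 3 * n) := by gcongr
  have h3 : c * (n - 9) * (n ^ 2 - 9) ≤ c * (n - 9) * (4 * m) := by
    apply mul_le_mul_of_nonneg_left (by linarith)
    exact mul_nonneg (by linarith) (by linarith)
  -- This comparison is the source of the bound n ≥ 36: it fails at c = 14, n = 34.
  have h4 : 4 * (n * (c + 2) * (6 * c + 3 * n)) < c * (n - 9) * (n ^ 2 - 9) := by
    obtain ⟨e, he, rfl⟩ : ∃ e, 0 ≤ e ∧ c = 15 + e := ⟨c - 15, by linarith, by ring⟩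
    rw [← sub_pos]
    rcases hn with rfl | rfl <;> ring_nf <;> positivity
  have h5 := mul_le_mul_of_nonneg_left h1 (by linarith : 0 ≤ c)
  nlinarith

/-- For 0-1 entries the inner sum counts the vertices that fail to distinguish x from y; it equals n
- d(x) - d(y) plus twice the codegree, and summing this over ordered edges produces degrees squared
and triangles. -/
theorem sum_mul_agreement {V : Type*} [Fintype V] {a : V → V → ℝ} (hs : ∀ x y, a x y = a y x) :
    ∑ x, ∑ y, a x y * ∑ z, (a x z * a y z + (1 - a x z) * (1 - a y z)) =
      Fintype.card V * (∑ x, ∑ y, a x y) - 2 * ∑ x, (∑ y, a x y) ^ 2 +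
        2 * ∑ x, ∑ y, ∑ z, a x y * (a x z * a y z) := by
  have h1 : ∀ x y, ∑ z, (a x z * a y z + (1 - a x z) * (1 - a y z)) =
      Fintype.card V - ∑ z, a x z - ∑ z, a y z + 2 * ∑ z, a x z * a y z := by
    intro x y
    rw [mul_sum, ← card_univ, ← nsmul_one, ← sum_const, ← sum_sub_distrib, ← sum_sub_distrib,
      ← sum_add_distrib]
    exact sum_congr rfl fun z _ => by ring
  have h2 : ∑ x, ∑ y, a x y * ∑ z, a x z = ∑ x, (∑ y, a x y) ^ 2 := by
    simp_rw [← sum_mul, sq]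
  have h3 : ∑ x, ∑ y, a x y * ∑ z, a y z = ∑ x, (∑ y, a x y) ^ 2 := by
    rw [sum_comm, ← h2]
    exact sum_congr rfl fun x _ => sum_congr rfl fun y _ => by rw [hs]
  have h4 : ∑ x, ∑ y, a x y * ∑ z, a x z * a y z =
      ∑ x, ∑ y, ∑ z, a x y * (a x z * a y z) := by
    simp_rw [mul_sum]
  have h5 : ∀ x y, a x y * ∑ z, (a x z * a y z + (1 - a x z) * (1 - a y z)) =
      (Fintype.card V : ℝ) * a x y - a x y * ∑ z, a x z - a x y * ∑ z, a y z +
        2 * (a x y * ∑ z, a x z * a y z) := by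
    intro x y
    rw [h1]
    ring
  simp only [h5]
  simp only [sum_add_distrib, sum_sub_distrib, ← mul_sum]
  rw [h2, h3, h4]
  ring

/-- If no such edge exists, every edge xy either has a vertex that does not distinguish its ends, or
has T(x) + T(y) ≥ 2c, where T is twice the number of triangles at a vertex. Summing over ordered
edges and applying Cauchy-Schwarz to the degrees contradicts `averaging_arithmetic`. -/
theorem exists_separating_edge {V : Type*} [Fintype V] {a : V → V → ℝ}
    (hs : ∀ x y, a x y = a y x) (h01 : ∀ x y, a x y = 0 ∨ a x y = 1) {c m t : ℝ} (hc : 15 ≤ c)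
    (hn : (Fintype.card V : ℝ) = 2 * c + 6 ∨ (Fintype.card V : ℝ) = 2 * c + 7)
    (hE : ∑ x, ∑ y, a x y = 2 * m) (hT : ∑ x, ∑ y, ∑ z, a x y * (a x z * a y z) = 6 * t)
    (hm : (Fintype.card V : ℝ) ^ 2 ≤ 4 * m + 9) (ht : t ≤ c + 2) :
    ∃ u v, a u v = 1 ∧ (∀ z, a u z ≠ a v z) ∧
      ∑ y, ∑ z, a u y * (a u z * a y z) + ∑ y, ∑ z, a v y * (a v z * a y z) < 2 * c := by
  by_contra! H
  set n : ℝ := (Fintype.card V : ℝ) with hnd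
  set T : V → ℝ := fun x => ∑ y, ∑ z, a x y * (a x z * a y z) with hTd
  have h0 : ∀ x y, 0 ≤ a x y := fun x y => by rcases h01 x y with h | h <;> simp [h]
  have h1 : ∀ x y, a x y ≤ 1 := fun x y => by rcases h01 x y with h | h <;> simp [h]
  have hag : ∀ x y z, 0 ≤ a x z * a y z + (1 - a x z) * (1 - a y z) := fun x y z =>
    add_nonneg (mul_nonneg (h0 _ _) (h0 _ _))
      (mul_nonneg (sub_nonneg.2 (h1 _ _)) (sub_nonneg.2 (h1 _ _)))
  have hT0 : ∀ x, 0 ≤ T x := fun x =>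
    sum_nonneg fun y _ => sum_nonneg fun z _ => mul_nonneg (h0 _ _) (mul_nonneg (h0 _ _) (h0 _ _))
  -- The weight 2c on the agreement count makes a single agreeing vertex sufficient, so both
  -- alternatives merge into one linear inequality.
  have key : ∀ x y, a x y * (2 * c) ≤
      2 * c * (a x y * ∑ z, (a x z * a y z + (1 - a x z) * (1 - a y z))) +
        a x y * T x + a x y * T y := by
    intro x y
    rcases h01 x y with h | h
    · simp [h]
    · rw [h]
      by_cases hz : ∀ z, a x z ≠ a y z
      · have := H x y h hz
        have h2 : 0 ≤ ∑ z, (a x z * a y z + (1 - a x z) * (1 - a y z)) :=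
          sum_nonneg fun z _ => hag x y z
        have h3 := mul_nonneg (by linarith : 0 ≤ 2 * c) h2
        simp only [hTd]
        linarith
      · push Not at hz
        obtain ⟨z, hz⟩ := hz
        have h2 : 1 ≤ ∑ z, (a x z * a y z + (1 - a x z) * (1 - a y z)) := by
          refine le_trans ?_ (single_le_sum (fun w _ => hag x y w) (mem_univ z))
          rw [hz]
          rcases h01 y z with h | h <;> simp [h]
        have h3 := mul_le_mul_of_nonneg_left h2 (by linarith : 0 ≤ 2 * c)
        have := hT0 x
        have := hT0 y
        linarith
  have hagree := sum_mul_agreement hs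
  obtain ⟨P, hP⟩ : ∃ P : V → V → ℝ, ∀ x y,
      ∑ z, (a x z * a y z + (1 - a x z) * (1 - a y z)) = P x y := ⟨_, fun _ _ => rfl⟩
  simp only [hP] at key hagree
  have hsum := sum_le_sum fun x (_ : x ∈ (univ : Finset V)) =>
    sum_le_sum fun y (_ : y ∈ (univ : Finset V)) => key x y
  simp only [sum_add_distrib, ← mul_sum] at hsum
  rw [hagree, ← hnd, hE, hT] at hsum
  simp only [← sum_mul] at hsum
  rw [hE] at hsum
  have hD : ∀ x, ∑ y, a x y ≤ n := fun x => by
    calc ∑ y, a x y ≤ ∑ y : V, (1 : ℝ) := sum_le_sum fun y _ => h1 x y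
      _ = n := by simp [hnd]
  have hTs : ∑ x, T x = 6 * t := hT
  have hDT : ∑ x, (∑ y, a x y) * T x ≤ n * (6 * t) := by
    rw [← hTs, mul_sum]
    exact sum_le_sum fun x _ => mul_le_mul_of_nonneg_right (hD x) (hT0 x)
  have hDT2 : ∑ x, ∑ y, a x y * T y ≤ n * (6 * t) := by
    rw [sum_comm]
    refine le_trans (le_of_eq ?_) hDT
    simp_rw [sum_mul]
    exact sum_congr rfl fun x _ => sum_congr rfl fun y _ => by rw [hs]
  have hcs : (2 * m) ^ 2 ≤ n * ∑ x, (∑ y, a x y) ^ 2 := by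
    rw [← hE, hnd, ← card_univ]
    exact sq_sum_le_card_mul_sum_sq
  have hfin := averaging_arithmetic hc hn hm ht
  have hn0 : 0 < n := by rcases hn with h | h <;> rw [h] <;> linarith
  have h5 := mul_le_mul_of_nonneg_left (hsum.trans (add_le_add (add_le_add le_rfl hDT) hDT2)) hn0.le
  have h6 := mul_le_mul_of_nonneg_left hcs (by linarith : 0 ≤ c)
  nlinarith

/-! ### Edges and triangles relative to a bipartition. -/

theorem exists_sum_adjMatrix_eq_two_mul {V : Type*} [Fintype V] [DecidableEq V]
    (G : SimpleGraph V) [DecidableRel G.Adj] (A : Finset V) :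
    ∃ s : ℕ, ∑ x ∈ A, ∑ y ∈ A, G.adjMatrix ℝ x y = 2 * s := by
  let H : SimpleGraph V :=
    { Adj := fun x y => (G.Adj x y ∧ x ∈ A ∧ y ∈ A)
      symm := ⟨fun x y h => ⟨h.1.symm, h.2.2, h.2.1⟩⟩
      loopless := ⟨fun x h => G.loopless.irrefl x h.1⟩ }
  have : DecidableRel H.Adj := fun x y => inferInstanceAs (Decidable (_ ∧ _))
  refine ⟨#H.edgeFinset, ?_⟩
  rw [← trace_adjMatrix_sq]
  simp only [trace, diag_apply, SimpleGraph.adjMatrix_mul_self_apply_self]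
  rw [← sum_filter_add_sum_filter_not univ (· ∈ A), filter_mem_eq_inter, univ_inter]
  rw [sum_eq_zero (s := filter _ _), add_zero]
  · refine sum_congr rfl fun x hx => ?_
    rw [SimpleGraph.degree, SimpleGraph.neighborFinset_eq_filter]
    simp only [SimpleGraph.adjMatrix_apply, sum_boole, Nat.cast_inj]
    congr 1
    ext y
    simp [H, hx, and_comm]
  · intro x hx
    rw [SimpleGraph.degree, SimpleGraph.neighborFinset_eq_filter]
    simp [H, (mem_filter.1 hx).2]

theorem sum_univ_eq_blocks {V : Type*} [Fintype V] [DecidableEq V] {a : V → V → ℝ}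
    (hs : ∀ x y, a x y = a y x) (A : Finset V) :
    ∑ x, ∑ y, a x y = ∑ x ∈ A, ∑ y ∈ A, a x y + ∑ x ∈ Aᶜ, ∑ y ∈ Aᶜ, a x y +
      2 * (#A * #Aᶜ - ∑ x ∈ A, ∑ y ∈ Aᶜ, (1 - a x y)) := by
  have h1 : ∑ x ∈ A, ∑ y ∈ Aᶜ, (1 - a x y) = #A * #Aᶜ - ∑ x ∈ A, ∑ y ∈ Aᶜ, a x y := by
    simp [sum_sub_distrib]
  have h2 : ∑ x ∈ Aᶜ, ∑ y ∈ A, a x y = ∑ x ∈ A, ∑ y ∈ Aᶜ, a x y := by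
    rw [sum_comm]
    exact sum_congr rfl fun x _ => sum_congr rfl fun y _ => hs _ _
  simp_rw [← sum_add_sum_compl A, sum_add_distrib]
  rw [h1, h2]
  ring

/-- Each vertex of the other part that is not a common neighbour accounts for a missing cross pair
at x or at y, and these pairs are distinct. -/
theorem card_sub_missing_le_common {V : Type*} [Fintype V] [DecidableEq V] {a : V → V → ℝ}
    (h01 : ∀ x y, a x y = 0 ∨ a x y = 1) {A : Finset V} {x y : V} (hx : x ∈ A) (hy : y ∈ A)
    (hxy : x ≠ y) :
    #Aᶜ - ∑ i ∈ A, ∑ z ∈ Aᶜ, (1 - a i z) ≤ ∑ z ∈ Aᶜ, a x z * a y z := by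
  have h0 : ∀ i z, 0 ≤ 1 - a i z := fun x y => by rcases h01 x y with h | h <;> simp [h]
  have h1 : ∑ z ∈ Aᶜ, (1 - a x z) + ∑ z ∈ Aᶜ, (1 - a y z) ≤ ∑ i ∈ A, ∑ z ∈ Aᶜ, (1 - a i z) := by
    rw [← sum_pair (f := fun i => ∑ z ∈ Aᶜ, (1 - a i z)) hxy]
    refine sum_le_sum_of_subset_of_nonneg ?_ fun i _ _ => sum_nonneg fun z _ => h0 i z
    intro i hi
    rcases mem_insert.1 hi with rfl | hi
    · exact hx
    · rwa [mem_singleton.1 hi]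
  have h2 : (#Aᶜ : ℝ) ≤ ∑ z ∈ Aᶜ, (a x z * a y z + ((1 - a x z) + (1 - a y z))) := by
    rw [← nsmul_one, ← sum_const]
    refine sum_le_sum fun z _ => ?_
    rcases h01 x z with h | h <;> rcases h01 y z with h' | h' <;> rw [h, h'] <;> norm_num
  rw [sum_add_distrib, sum_add_distrib] at h2
  linarith

/-- The factor 3 is the number of positions that the vertex alone in its part can take in an ordered
triple; triangles inside one part are discarded. -/
theorem three_mul_mixed_triangles_le {V : Type*} [Fintype V] [DecidableEq V] {a : V → V → ℝ}
    (hs : ∀ x y, a x y = a y x) (h0 : ∀ x y, 0 ≤ a x y) (A : Finset V) :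
    3 * ((∑ x ∈ A, ∑ y ∈ A, a x y * ∑ z ∈ Aᶜ, a x z * a y z) +
      ∑ x ∈ Aᶜ, ∑ y ∈ Aᶜ, a x y * ∑ z ∈ A, a x z * a y z) ≤
      ∑ x, ∑ y, ∑ z, a x y * (a x z * a y z) := by
  set W : Finset V → Finset V → Finset V → ℝ := fun P Q R =>
    ∑ x ∈ P, ∑ y ∈ Q, ∑ z ∈ R, a x y * (a x z * a y z) with hW
  have hW0 : ∀ P Q R, 0 ≤ W P Q R := fun P Q R =>
    sum_nonneg fun x _ => sum_nonneg fun y _ => sum_nonneg fun z _ =>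
      mul_nonneg (h0 _ _) (mul_nonneg (h0 _ _) (h0 _ _))
  have hW1 : ∀ P Q R, W P Q R = W Q P R := fun P Q R => by
    simp only [hW]
    rw [sum_comm]
    refine sum_congr rfl fun x _ => sum_congr rfl fun y _ => sum_congr rfl fun z _ => ?_
    rw [hs y x, mul_comm (a y z)]
  have hW2 : ∀ P Q R, W P Q R = W P R Q := fun P Q R => by
    simp only [hW]
    refine sum_congr rfl fun x _ => ?_
    rw [sum_comm]
    refine sum_congr rfl fun y _ => sum_congr rfl fun z _ => ?_
    rw [hs z y]
    ring
  have e1 : ∑ x, ∑ y, ∑ z, a x y * (a x z * a y z) =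
      W A A A + W A A Aᶜ + W A Aᶜ A + W A Aᶜ Aᶜ + W Aᶜ A A + W Aᶜ A Aᶜ + W Aᶜ Aᶜ A +
        W Aᶜ Aᶜ Aᶜ := by
    simp only [hW]
    simp_rw [← sum_add_sum_compl A, sum_add_distrib]
    ring
  have e2 : ∑ x ∈ A, ∑ y ∈ A, a x y * ∑ z ∈ Aᶜ, a x z * a y z = W A A Aᶜ := by
    simp only [hW, mul_sum]
  have e3 : ∑ x ∈ Aᶜ, ∑ y ∈ Aᶜ, a x y * ∑ z ∈ A, a x z * a y z = W Aᶜ Aᶜ A := by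
    simp only [hW, mul_sum]
  rw [e1, e2, e3, hW2 A Aᶜ A, hW1 Aᶜ A A, hW2 A Aᶜ A, hW1 A Aᶜ Aᶜ, hW2 Aᶜ A Aᶜ]
  linarith [hW0 A A A, hW0 Aᶜ Aᶜ Aᶜ]

theorem inside_mul_le_triangles {V : Type*} [Fintype V] [DecidableEq V] {a : V → V → ℝ}
    (hs : ∀ x y, a x y = a y x) (h01 : ∀ x y, a x y = 0 ∨ a x y = 1) (hd : ∀ x, a x x = 0)
    (A : Finset V) :
    3 * ((∑ x ∈ A, ∑ y ∈ A, a x y) * (#Aᶜ - ∑ i ∈ A, ∑ z ∈ Aᶜ, (1 - a i z)) +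
      (∑ x ∈ Aᶜ, ∑ y ∈ Aᶜ, a x y) * (#A - ∑ i ∈ A, ∑ z ∈ Aᶜ, (1 - a i z))) ≤
      ∑ x, ∑ y, ∑ z, a x y * (a x z * a y z) := by
  have h0 : ∀ x y, 0 ≤ a x y := fun x y => by rcases h01 x y with h | h <;> simp [h]
  have key : ∀ B : Finset V, (∑ x ∈ B, ∑ y ∈ B, a x y) * (#Bᶜ - ∑ i ∈ B, ∑ z ∈ Bᶜ, (1 - a i z)) ≤
      ∑ x ∈ B, ∑ y ∈ B, a x y * ∑ z ∈ Bᶜ, a x z * a y z := by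
    intro B
    simp_rw [sum_mul]
    refine sum_le_sum fun x hx => sum_le_sum fun y hy => ?_
    by_cases hxy : x = y
    · subst hxy
      simp [hd]
    · exact mul_le_mul_of_nonneg_left (card_sub_missing_le_common h01 hx hy hxy) (h0 _ _)
  refine le_trans ?_ (three_mul_mixed_triangles_le hs h0 A)
  have h1 := key A
  have h2 := key Aᶜ
  have h3 : ∑ i ∈ Aᶜ, ∑ z ∈ A, (1 - a i z) = ∑ i ∈ A, ∑ z ∈ Aᶜ, (1 - a i z) := by
    rw [sum_comm]
    exact sum_congr rfl fun x _ => sum_congr rfl fun y _ => by rw [hs]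
  rw [compl_compl, h3] at h2
  linarith

/-! ### The spectral bound for one inside edge and q missing cross edges. -/

/-- A spectral bound for a graph obtained from a complete bipartite graph with parts `A` and `Aᶜ`
by adding the edge `xy` inside `A` and deleting `q` edges between the parts. -/
theorem perron_bound {V : Type*} [Fintype V] [DecidableEq V] {a : V → V → ℝ}
    (hs : ∀ x y, a x y = a y x) (h01 : ∀ x y, a x y = 0 ∨ a x y = 1) {A : Finset V} {x y : V}
    (hx : x ∈ A) (hy : y ∈ A) (hxy : x ≠ y)
    (hA : ∀ i ∈ A, ∀ j ∈ A, a i j = if (i = x ∧ j = y) ∨ (i = y ∧ j = x) then 1 else 0)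
    (hB : ∀ i ∈ Aᶜ, ∀ j ∈ Aᶜ, a i j = 0) {q : ℝ} (hq : ∑ i ∈ A, ∑ j ∈ Aᶜ, (1 - a i j) = q)
    {l : ℝ} (hl : 1 < l) {v : V → ℝ} (hv : v ≠ 0) (hv0 : ∀ i, 0 ≤ v i)
    (he : ∀ i, ∑ j, a i j * v j = l * v i) :
    (l ^ 2 - #A * #Aᶜ) * (l ^ 2 * (l - 1)) ≤ 2 * l ^ 2 * #Aᶜ -
      q * (2 * l ^ 2 * (l - 1) - 2 * #Aᶜ - q * #A * (l - 1) - q * l * #Aᶜ) := by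
  set S := ∑ i ∈ A, v i with hS
  set R := ∑ j ∈ Aᶜ, v j with hR
  set p := v x + v y with hp
  have hm0 : ∀ i j, 0 ≤ 1 - a i j := fun i j => by rcases h01 i j with h | h <;> simp [h]
  have hS0 : 0 ≤ S := sum_nonneg fun i _ => hv0 i
  have hR0 : 0 ≤ R := sum_nonneg fun i _ => hv0 i
  have hq0 : 0 ≤ q := hq ▸ sum_nonneg fun i _ => sum_nonneg fun j _ => hm0 i j
  have hrow : ∀ i ∈ A, ∑ j ∈ Aᶜ, (1 - a i j) ≤ q := fun i hi => hq ▸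
    single_le_sum (f := fun i => ∑ j ∈ Aᶜ, (1 - a i j))
      (fun i _ => sum_nonneg fun j _ => hm0 i j) hi
  have hcol : ∀ j ∈ Aᶜ, ∑ i ∈ A, (1 - a i j) ≤ q := fun j hj => by
    rw [← hq, sum_comm]
    exact single_le_sum (f := fun j => ∑ i ∈ A, (1 - a i j))
      (fun j _ => sum_nonneg fun i _ => hm0 i j) hj
  have eA : ∀ i ∈ A, l * v i = R - ∑ j ∈ Aᶜ, (1 - a i j) * v j +
      ((if i = x then v y else 0) + if i = y then v x else 0) := by
    intro i hi
    rw [← he, ← sum_add_sum_compl A, hR, ← sum_sub_distrib, add_comm]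
    congr 1
    · exact sum_congr rfl fun j _ => by ring
    · rw [sum_congr rfl fun j hj => by rw [hA i hi j hj]]
      by_cases h1 : i = x
      · subst h1
        simp [hxy, hy]
      · by_cases h2 : i = y
        · subst h2
          simp [h1, hx]
        · simp [h1, h2]
  have eB : ∀ j ∈ Aᶜ, l * v j = S - ∑ i ∈ A, (1 - a i j) * v i := by
    intro j hj
    rw [← he, ← sum_add_sum_compl A, hS, ← sum_sub_distrib,
      sum_eq_zero (s := Aᶜ) fun i hi => by rw [hB j hj i hi, zero_mul], add_zero]
    exact sum_congr rfl fun i _ => by rw [hs]; ring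
  -- The final inequality is divided by S. If S vanished, v would vanish on A, and then on the
  -- complement by `eB`.
  have hSpos : 0 < S := by
    refine lt_of_le_of_ne hS0 fun h => hv (funext fun i => ?_)
    have hzA : ∀ i ∈ A, v i = 0 := (sum_eq_zero_iff_of_nonneg fun i _ => hv0 i).1 h.symm
    by_cases hi : i ∈ A
    · exact hzA i hi
    · have := eB i (mem_compl.2 hi)
      rw [← h, sum_eq_zero fun j hj => by rw [hzA j hj, mul_zero], sub_zero] at this
      exact (mul_eq_zero.1 this).resolve_left (by linarith)
  have mA : ∀ i, 0 ≤ ∑ j ∈ Aᶜ, (1 - a i j) * v j := fun i =>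
    sum_nonneg fun j _ => mul_nonneg (hm0 _ _) (hv0 _)
  have mB : ∀ j, 0 ≤ ∑ i ∈ A, (1 - a i j) * v i := fun j =>
    sum_nonneg fun i _ => mul_nonneg (hm0 _ _) (hv0 _)
  have uB : ∀ j ∈ Aᶜ, l * v j ≤ S := fun j hj => by rw [eB j hj]; linarith [mB j]
  have ex := eA x hx
  have ey := eA y hy
  simp only [if_true, hxy, hxy.symm, if_false, add_zero, zero_add] at ex ey
  have hpR : (l - 1) * p ≤ 2 * R := by
    rw [hp]
    linarith [mA x, mA y]
  -- For i = x or i = y the two equations at x and y are coupled; l times one plus the other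
  -- eliminates the partner entry and leaves a common factor l + 1.
  have uA : ∀ i ∈ A, (l - 1) * v i ≤ R := by
    intro i hi
    by_cases h1 : i = x
    · subst h1
      have h2 : (l + 1) * ((l - 1) * v i) ≤ (l + 1) * R := by
        nlinarith [mA i, mA y, mul_nonneg (by linarith : 0 ≤ l) (mA i)]
      exact le_of_mul_le_mul_left h2 (by linarith)
    · by_cases h2 : i = y
      · subst h2
        have h2 : (l + 1) * ((l - 1) * v i) ≤ (l + 1) * R := by
          nlinarith [mA i, mA x, mul_nonneg (by linarith : 0 ≤ l) (mA i)]
        exact le_of_mul_le_mul_left h2 (by linarith)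
      · have := eA i hi
        simp only [h1, h2, if_false, add_zero] at this
        linarith [mA i, hv0 i]
  have lA : ∀ i ∈ A, l * R - q * S ≤ l ^ 2 * v i := by
    intro i hi
    have h1 : l * ∑ j ∈ Aᶜ, (1 - a i j) * v j ≤ q * S := by
      calc l * ∑ j ∈ Aᶜ, (1 - a i j) * v j = ∑ j ∈ Aᶜ, (1 - a i j) * (l * v j) := by
            rw [mul_sum]
            exact sum_congr rfl fun j _ => by ring
        _ ≤ ∑ j ∈ Aᶜ, (1 - a i j) * S :=
            sum_le_sum fun j hj => mul_le_mul_of_nonneg_left (uB j hj) (hm0 _ _)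
        _ ≤ q * S := by
            rw [← sum_mul]
            exact mul_le_mul_of_nonneg_right (hrow i hi) hS0
    have h2 : 0 ≤ ((if i = x then v y else 0) + if i = y then v x else 0) := by
      split_ifs <;> simp [hv0, add_nonneg]
    have h3 := congrArg (fun z => l * z) (eA i hi)
    beta_reduce at h3
    nlinarith [mul_nonneg (by linarith : 0 ≤ l) h2]
  have lB : ∀ j ∈ Aᶜ, (l - 1) * S - q * R ≤ (l - 1) * (l * v j) := by
    intro j hj
    have h1 : (l - 1) * ∑ i ∈ A, (1 - a i j) * v i ≤ q * R := by
      calc (l - 1) * ∑ i ∈ A, (1 - a i j) * v i = ∑ i ∈ A, (1 - a i j) * ((l - 1) * v i) := by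
            rw [mul_sum]
            exact sum_congr rfl fun j _ => by ring
        _ ≤ ∑ i ∈ A, (1 - a i j) * R :=
            sum_le_sum fun i hi => mul_le_mul_of_nonneg_left (uA i hi) (hm0 _ _)
        _ ≤ q * R := by
            rw [← sum_mul]
            exact mul_le_mul_of_nonneg_right (hcol j hj) hR0
    rw [eB j hj]
    linarith
  set QB := ∑ i ∈ A, ∑ j ∈ Aᶜ, (1 - a i j) * v j with hQB
  set QA := ∑ i ∈ A, ∑ j ∈ Aᶜ, (1 - a i j) * v i with hQA
  have sA : l * S = #A * R - QB + p := by
    rw [hS, mul_sum, sum_congr rfl eA, sum_add_distrib, sum_sub_distrib, sum_const,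
      nsmul_eq_mul, sum_add_distrib, sum_ite_eq' A x, sum_ite_eq' A y, if_pos hx, if_pos hy,
      add_comm (v y), hQB]
  have sB : l * R = #Aᶜ * S - QA := by
    rw [hR, mul_sum, sum_congr rfl eB, sum_sub_distrib, sum_const, nsmul_eq_mul, hQA, sum_comm]
  clear_value S R
  have hqc : ∀ c, q * c = ∑ i ∈ A, ∑ j ∈ Aᶜ, (1 - a i j) * c := fun c => by
    simp only [← hq, sum_mul]
  have lQA : q * (l * R - q * S) ≤ l ^ 2 * QA := by
    rw [hQA, hqc, mul_sum]
    refine sum_le_sum fun i hi => ?_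
    rw [mul_sum]
    refine sum_le_sum fun j hj => ?_
    have := mul_le_mul_of_nonneg_left (lA i hi) (hm0 i j)
    linarith
  have lQB : q * ((l - 1) * S - q * R) ≤ (l - 1) * (l * QB) := by
    rw [hQB, hqc, mul_sum, mul_sum]
    refine sum_le_sum fun i hi => ?_
    rw [mul_sum, mul_sum]
    refine sum_le_sum fun j hj => ?_
    have := mul_le_mul_of_nonneg_left (lB j hj) (hm0 i j)
    linarith
  have hQB0 : 0 ≤ QB := sum_nonneg fun i _ => mA i
  have hQA0 : 0 ≤ QA := sum_nonneg fun i _ => sum_nonneg fun j _ => mul_nonneg (hm0 _ _) (hv0 _)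
  have hlR : l * R ≤ #Aᶜ * S := by linarith
  have haR : (l - 1) * (l * S) - 2 * R ≤ (l - 1) * (#A * R) := by
    rw [sA]
    have := mul_nonneg (by linarith : 0 ≤ l - 1) hQB0
    linarith
  -- The gain comes from the inside edge through p, the loss from the missing edges through QA and
  -- QB. Below, p is bounded above, QA and QB below, and R is traded for S.
  have hmain : (l ^ 2 - #A * #Aᶜ) * S = l * p - #A * QA - l * QB := by
    linear_combination l * sA + #A * sB
  have hα : (0 : ℝ) ≤ #A := Nat.cast_nonneg _
  generalize (#A : ℝ) = α at *
  generalize (#Aᶜ : ℝ) = β at *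
  refine le_of_mul_le_mul_right ?_ hSpos
  have k1 := mul_le_mul_of_nonneg_left hpR (by positivity : 0 ≤ l ^ 3)
  have k2 := mul_le_mul_of_nonneg_left lQA (mul_nonneg hα (by linarith) : 0 ≤ α * (l - 1))
  have k3 := mul_le_mul_of_nonneg_left lQB (by positivity : 0 ≤ l ^ 2)
  have k4 := mul_le_mul_of_nonneg_left haR (by positivity : 0 ≤ q * l)
  have k5 := mul_le_mul_of_nonneg_left hlR (by positivity : 0 ≤ 2 * l ^ 2 + 2 * q + q ^ 2 * l)
  have k6 : (l ^ 2 - α * β) * (l ^ 2 * (l - 1)) * S =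
    l ^ 2 * (l - 1) * (l * p - α * QA - l * QB) := by rw [← hmain]; ring
  rw [k6]
  linarith

/-- To leading order `h` says K ≤ 2 - 2q, and the error is below 1 once l ≥ 18. The listed cases
cover the integers K ≥ 0 and 0 ≤ q ≤ 3 with K + 2q ≥ 3. -/
theorem perron_bound_contradiction {l a b q K : ℝ} (hl : 18 ≤ l) (ha : a ≤ l + 2) (hb : b ≤ l + 2)
    (hq : q = 0 ∧ 3 ≤ K ∨ q = 1 ∧ 1 ≤ K ∨ q = 2 ∧ 0 ≤ K ∨ q = 3 ∧ 0 ≤ K)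
    (h : K * (l ^ 2 * (l - 1)) ≤ 2 * l ^ 2 * b -
      q * (2 * l ^ 2 * (l - 1) - 2 * b - q * a * (l - 1) - q * l * b)) : False := by
  have h0 : 0 ≤ l ^ 2 * (l - 1) := mul_nonneg (by positivity) (by linarith)
  have h1 : l ^ 2 * b ≤ l ^ 2 * (l + 2) := mul_le_mul_of_nonneg_left hb (by positivity)
  have h2 : l * b ≤ l * (l + 2) := mul_le_mul_of_nonneg_left hb (by positivity)
  have h3 : a * (l - 1) ≤ (l + 2) * (l - 1) := mul_le_mul_of_nonneg_right ha (by linarith)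
  have h4 : 18 * l ≤ l ^ 2 := by nlinarith
  have h5 : 18 * l ^ 2 ≤ l ^ 3 := by nlinarith
  rcases hq with ⟨rfl, hK⟩ | ⟨rfl, hK⟩ | ⟨rfl, hK⟩ | ⟨rfl, hK⟩ <;>
    have h6 := mul_le_mul_of_nonneg_right hK h0 <;> linarith

/-! ### Existence of a partition with at most one inside edge. -/

/-- A part smaller than h is compensated: an unbalanced partition has fewer cross pairs, hence
leaves room for fewer missing ones. -/
theorem le_sub_add_of_balanced {b n h : ℤ} (hn : n = 2 * h ∨ n = 2 * h + 1) :
    h ≤ b - b * (n - b) + h * (n - h) := by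
  obtain ⟨j, rfl⟩ : ∃ j, b = h + j := ⟨b - h, by ring⟩
  have h1 : 0 ≤ j * (j + 1) := by
    rcases le_or_gt 0 j with h | h
    · exact mul_nonneg h (by omega)
    · exact mul_nonneg_of_nonpos_of_nonpos (by omega) (by omega)
  rcases hn with rfl | rfl <;> nlinarith [sq_nonneg j]

theorem sum_sum_adjMatrix {V : Type*} [Fintype V] [DecidableEq V] (G : SimpleGraph V)
    [DecidableRel G.Adj] : ∑ x, ∑ y, G.adjMatrix ℝ x y = 2 * (#G.edgeFinset : ℝ) := by
  rw [← trace_adjMatrix_sq]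
  simp only [trace, diag_apply, SimpleGraph.adjMatrix_mul_self_apply_self]
  refine sum_congr rfl fun x _ => ?_
  simp [SimpleGraph.adjMatrix_apply, SimpleGraph.degree, SimpleGraph.neighborFinset_eq_filter]

theorem adjMatrix_symm {V : Type*} (G : SimpleGraph V) [DecidableRel G.Adj] (x y : V) :
    G.adjMatrix ℝ x y = G.adjMatrix ℝ y x := by
  simp only [SimpleGraph.adjMatrix_apply, G.adj_comm]

theorem adjMatrix_eq_zero_or_one {V : Type*} (G : SimpleGraph V) [DecidableRel G.Adj] (x y : V) :
    G.adjMatrix ℝ x y = 0 ∨ G.adjMatrix ℝ x y = 1 := by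
  rw [SimpleGraph.adjMatrix_apply]; split_ifs <;> simp

theorem adjMatrix_eq_one_iff {V : Type*} (G : SimpleGraph V) [DecidableRel G.Adj] {x y : V} :
    G.adjMatrix ℝ x y = 1 ↔ G.Adj x y := by
  simp [SimpleGraph.adjMatrix_apply]

theorem adjMatrix_eq_zero_iff {V : Type*} (G : SimpleGraph V) [DecidableRel G.Adj] {x y : V} :
    G.adjMatrix ℝ x y = 0 ↔ ¬ G.Adj x y := by
  simp [SimpleGraph.adjMatrix_apply]

/-- A graph with almost `n² / 4` edges and fewer than `⌊n / 2⌋` triangles has a vertex partition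
with at most one edge inside the parts. -/
theorem exists_partition {V : Type*} [Fintype V] [DecidableEq V] (G : SimpleGraph V)
    [DecidableRel G.Adj] {n h : ℕ} (hV : Fintype.card V = n) (hn : n = 2 * h ∨ n = 2 * h + 1)
    (hh : 18 ≤ h) (hm : h * (n - h) ≤ #G.edgeFinset + 2) (ht : triangleCount G + 1 ≤ h) :
    ∃ A : Finset V, (∑ x ∈ A, ∑ y ∈ A, G.adjMatrix ℝ x y = 0 ∨
        ∑ x ∈ A, ∑ y ∈ A, G.adjMatrix ℝ x y = 2) ∧
      ∑ x ∈ Aᶜ, ∑ y ∈ Aᶜ, G.adjMatrix ℝ x y = 0 := by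
  set a := G.adjMatrix ℝ with ha
  have hs : ∀ x y, a x y = a y x := adjMatrix_symm G
  have h01 : ∀ x y, a x y = 0 ∨ a x y = 1 := adjMatrix_eq_zero_or_one G
  have hd : ∀ x, a x x = 0 := fun x => by simp [ha]
  have hE := sum_sum_adjMatrix G
  have hT := sum_adjMatrix_triangle G
  have hhr : (18 : ℝ) ≤ h := by exact_mod_cast hh
  have hnr : (n : ℝ) = 2 * h ∨ (n : ℝ) = 2 * h + 1 := by exact_mod_cast hn
  have htr : (triangleCount G : ℝ) + 1 ≤ h := by exact_mod_cast ht
  have hmr : (h : ℝ) * (n - h) ≤ #G.edgeFinset + 2 := by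
    rw [← Nat.cast_sub (by omega)]
    exact_mod_cast hm
  obtain ⟨u, v, huv, hsep, hlt⟩ := exists_separating_edge hs h01 (c := (h : ℝ) - 3)
    (m := #G.edgeFinset) (t := triangleCount G) (by linarith)
    (by rw [hV]; rcases hnr with h | h <;> rw [h] <;> [left; right] <;> ring) hE hT
    (by rw [hV]; rcases hnr with h | h <;> rw [h] at hmr ⊢ <;> nlinarith) (by linarith)
  -- The parts are the neighbourhoods of v and u. An edge inside one of them closes a triangle with
  -- v or u, so the triangle bound `hlt` becomes a bound on inside edges.
  set A : Finset V := univ.filter fun z => a v z = 1 with hA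
  have hAc : Aᶜ = univ.filter fun z => a u z = 1 := by
    ext z
    have := hsep z
    simp only [hA, mem_compl, mem_filter, mem_univ, true_and]
    rcases h01 u z with h | h <;> rcases h01 v z with h' | h' <;>
      rw [h, h'] at this <;> first | exact absurd rfl this | (rw [h, h']; norm_num)
  have hnbr : ∀ w, ∑ y, ∑ z, a w y * (a w z * a y z) =
      ∑ y with a w y = 1, ∑ z with a w z = 1, a y z := by
    intro w
    rw [sum_filter]
    refine sum_congr rfl fun y _ => ?_
    rw [sum_filter]
    split_ifs with hy
    · refine sum_congr rfl fun z _ => ?_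
      rcases h01 w z with hz | hz <;> simp [hy, hz]
    · simp [(h01 w y).resolve_right hy]
  rw [hnbr, hnbr, ← hA, ← hAc] at hlt
  obtain ⟨s₁, hs₁⟩ := exists_sum_adjMatrix_eq_two_mul G A
  obtain ⟨s₂, hs₂⟩ := exists_sum_adjMatrix_eq_two_mul G Aᶜ
  rw [← ha] at hs₁ hs₂
  have hblocks := sum_univ_eq_blocks hs A
  have hcount := inside_mul_le_triangles hs h01 hd A
  rw [hs₁, hs₂] at hlt hblocks hcount
  rw [hE] at hblocks
  rw [hT] at hcount
  have hcardn : #A + #Aᶜ = n := by rw [card_add_card_compl, hV]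
  have hnz : (n : ℤ) = 2 * h ∨ (n : ℤ) = 2 * h + 1 := by exact_mod_cast hn
  have hb₁ := le_sub_add_of_balanced (b := #Aᶜ) hnz
  have hb₂ := le_sub_add_of_balanced (b := #A) hnz
  have hb₁' : (h : ℝ) ≤ #Aᶜ - #Aᶜ * (n - #Aᶜ) + h * (n - h) := by exact_mod_cast hb₁
  have hb₂' : (h : ℝ) ≤ #A - #A * (n - #A) + h * (n - h) := by exact_mod_cast hb₂
  have hcr : (n : ℝ) = #A + #Aᶜ := by exact_mod_cast hcardn.symm
  set q := ∑ i ∈ A, ∑ z ∈ Aᶜ, (1 - a i z) with hq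
  have c₁ : (h : ℝ) - (s₁ + s₂) - 2 ≤ #Aᶜ - q := by
    rw [hcr] at hb₁' hmr
    linarith
  have c₂ : (h : ℝ) - (s₁ + s₂) - 2 ≤ #A - q := by
    rw [hcr] at hb₂' hmr
    linarith
  have d₁ := mul_le_mul_of_nonneg_left c₁ (by positivity : (0 : ℝ) ≤ 2 * s₁)
  have d₂ := mul_le_mul_of_nonneg_left c₂ (by positivity : (0 : ℝ) ≤ 2 * s₂)
  -- With s = s₁ + s₂, the left side is concave in s and symmetric under s ↦ h - 2 - s, so on 2 ≤ s
  -- ≤ h - 4 it is at least 2(h - 4) > h - 1. The choice c = h - 3 above supplies exactly s ≤ h - 4.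
  have hfin : ((s₁ : ℝ) + s₂) * (h - (s₁ + s₂) - 2) ≤ h - 1 := by linarith
  have hlt' : s₁ + s₂ + 4 ≤ h := by
    have : (s₁ : ℝ) + s₂ + 3 < h := by linarith
    exact_mod_cast this
  have hle : s₁ + s₂ ≤ 1 := by
    by_contra! h2
    obtain ⟨s, hs⟩ : ∃ s, s₁ + s₂ = s + 2 := ⟨s₁ + s₂ - 2, by omega⟩
    obtain ⟨r, hr⟩ : ∃ r, h = s + 6 + r := ⟨h - (s + 6), by omega⟩
    have e1 : (s₁ : ℝ) + s₂ = s + 2 := by exact_mod_cast hs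
    have e2 : (h : ℝ) = s + 6 + r := by exact_mod_cast hr
    rw [e1, e2] at hfin
    have : (0 : ℝ) ≤ s * r := by positivity
    have : (0 : ℝ) ≤ r := by positivity
    rw [e2] at hhr
    linarith
  rcases Nat.eq_zero_or_pos s₂ with h2 | h2
  · refine ⟨A, ?_, by rw [hs₂, h2]; simp⟩
    rw [hs₁]
    rcases (by omega : s₁ = 0 ∨ s₁ = 1) with h1 | h1 <;> simp [h1]
  · obtain ⟨rfl, rfl⟩ : s₁ = 0 ∧ s₂ = 1 := by omega
    refine ⟨Aᶜ, Or.inr (by rw [hs₂]; simp), by rw [compl_compl, hs₁]; simp⟩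

/-! ### From block sums to adjacency, and recognition of the extremal graphs. -/

theorem not_adj_of_sum_eq_zero {V : Type*} [Fintype V] [DecidableEq V] (G : SimpleGraph V)
    [DecidableRel G.Adj] {A : Finset V} (h : ∑ x ∈ A, ∑ y ∈ A, G.adjMatrix ℝ x y = 0) {i j : V}
    (hi : i ∈ A) (hj : j ∈ A) : ¬ G.Adj i j := by
  rw [← adjMatrix_eq_zero_iff]
  exact (sum_eq_zero_iff_of_nonneg fun y _ => adjMatrix_nonneg G i y).1
    ((sum_eq_zero_iff_of_nonneg fun x _ => sum_nonneg fun y _ => adjMatrix_nonneg G x y).1 h i hi)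
    j hj

theorem exists_unique_edge_of_sum_eq_two {V : Type*} [Fintype V] [DecidableEq V]
    (G : SimpleGraph V) [DecidableRel G.Adj] {A : Finset V}
    (h : ∑ x ∈ A, ∑ y ∈ A, G.adjMatrix ℝ x y = 2) :
    ∃ x ∈ A, ∃ y ∈ A, x ≠ y ∧ ∀ i ∈ A, ∀ j ∈ A,
      (G.Adj i j ↔ (i = x ∧ j = y) ∨ (i = y ∧ j = x)) := by
  replace h : ∑ p ∈ A ×ˢ A, G.adjMatrix ℝ p.1 p.2 = 2 := by rwa [sum_product]
  obtain ⟨⟨x, y⟩, hxy, hne⟩ := exists_ne_zero_of_sum_ne_zero (by rw [h]; norm_num)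
  obtain ⟨hx, hy⟩ := mem_product.1 hxy
  have hadj : G.Adj x y := by
    by_contra hc
    exact hne ((adjMatrix_eq_zero_iff G).2 hc)
  refine ⟨x, hx, y, hy, hadj.ne, fun i hi j hj => ⟨fun hij => ?_, ?_⟩⟩
  · by_contra hc
    push Not at hc
    have hsub : ({(x, y), (y, x), (i, j)} : Finset (V × V)) ⊆ A ×ˢ A := by
      intro p hp
      simp only [mem_insert, mem_singleton] at hp
      rcases hp with rfl | rfl | rfl <;> simp [*]
    have h1 := sum_le_sum_of_subset_of_nonneg (f := fun p : V × V => G.adjMatrix ℝ p.1 p.2) hsub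
      fun p _ _ => adjMatrix_nonneg G _ _
    rw [h, sum_insert, sum_insert, sum_singleton, (adjMatrix_eq_one_iff G).2 hadj,
      (adjMatrix_eq_one_iff G).2 hadj.symm, (adjMatrix_eq_one_iff G).2 hij] at h1
    · norm_num at h1
    · simp only [mem_singleton, Prod.mk.injEq]
      rintro ⟨rfl, rfl⟩
      exact hc.2 rfl rfl
    · simp only [mem_insert, mem_singleton, Prod.mk.injEq]
      rintro (⟨rfl, -⟩ | ⟨rfl, rfl⟩)
      · exact hadj.ne rfl
      · exact hc.1 rfl rfl
  · rintro (⟨rfl, rfl⟩ | ⟨rfl, rfl⟩)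
    · exact hadj
    · exact hadj.symm

theorem bipartitePlus_adj_inl_inl {a b : ℕ} (i j : Fin a) :
    (bipartitePlus a b).Adj (Sum.inl i) (Sum.inl j) ↔
      (i.val = 0 ∧ j.val = 1) ∨ (i.val = 1 ∧ j.val = 0) := by
  simp only [bipartitePlus, SimpleGraph.sup_adj, completeBipartiteGraph_adj,
    SimpleGraph.fromRel_adj, Sum.inl.injEq, ne_eq]
  constructor
  · rintro (h | ⟨-, ⟨i', j', h1, h2, rfl, rfl⟩ | ⟨i', j', h1, h2, rfl, rfl⟩⟩)
    · simp at h
    · exact Or.inl ⟨h1, h2⟩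
    · exact Or.inr ⟨h2, h1⟩
  · rintro (⟨h1, h2⟩ | ⟨h1, h2⟩)
    · exact Or.inr ⟨by rintro rfl; omega, Or.inl ⟨i, j, h1, h2, rfl, rfl⟩⟩
    · exact Or.inr ⟨by rintro rfl; omega, Or.inr ⟨j, i, h2, h1, rfl, rfl⟩⟩

theorem bipartitePlus_adj_inl_inr {a b : ℕ} (i : Fin a) (j : Fin b) :
    (bipartitePlus a b).Adj (Sum.inl i) (Sum.inr j) := by
  simp [bipartitePlus]

theorem bipartitePlus_not_adj_inr_inr {a b : ℕ} (i j : Fin b) :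
    ¬ (bipartitePlus a b).Adj (Sum.inr i) (Sum.inr j) := by
  simp [bipartitePlus]

theorem bipartitePlusMinus_adj_inl_inl {a b : ℕ} (i j : Fin a) :
    (bipartitePlusMinus a b).Adj (Sum.inl i) (Sum.inl j) ↔
      (i.val = 0 ∧ j.val = 1) ∨ (i.val = 1 ∧ j.val = 0) := by
  rw [bipartitePlusMinus, SimpleGraph.deleteEdges_adj, bipartitePlus_adj_inl_inl]
  simp

theorem bipartitePlusMinus_adj_inl_inr {a b : ℕ} (i : Fin a) (j : Fin b) :
    (bipartitePlusMinus a b).Adj (Sum.inl i) (Sum.inr j) ↔ ¬ (i.val = 0 ∧ j.val = 0) := by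
  rw [bipartitePlusMinus, SimpleGraph.deleteEdges_adj]
  simp only [bipartitePlus_adj_inl_inr, true_and, not_iff_not]
  constructor
  · rintro ⟨i', j', h1, h2, h3⟩
    simp only [Sym2.eq_iff, Sum.inl.injEq, Sum.inr.injEq, reduceCtorEq, and_self, or_false] at h3
    rw [h3.1, h3.2]
    exact ⟨h1, h2⟩
  · rintro ⟨h1, h2⟩
    exact ⟨i, j, h1, h2, rfl⟩

theorem bipartitePlusMinus_not_adj_inr_inr {a b : ℕ} (i j : Fin b) :
    ¬ (bipartitePlusMinus a b).Adj (Sum.inr i) (Sum.inr j) := by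
  rw [bipartitePlusMinus, SimpleGraph.deleteEdges_adj]
  exact fun h => bipartitePlus_not_adj_inr_inr i j h.1

theorem exists_equiv_fin_of_ne {α : Type*} [Fintype α] {a : ℕ} (h : Fintype.card α = a)
    {x y : α} (hxy : x ≠ y) : ∃ e : α ≃ Fin a, (e x).val = 0 ∧ (e y).val = 1 := by
  have ha : 1 < a := h ▸ Fintype.one_lt_card_iff.2 ⟨x, y, hxy⟩
  let e₀ : α ≃ Fin a := Fintype.equivFinOfCardEq h
  let f := e₀.trans (Equiv.swap (e₀ x) ⟨0, by omega⟩)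
  have hfx : f x = ⟨0, by omega⟩ := by simp [f]
  have hfy : f x ≠ f y := f.injective.ne hxy
  refine ⟨f.trans (Equiv.swap (f y) ⟨1, ha⟩), ?_, by simp⟩
  rw [Equiv.trans_apply, Equiv.swap_apply_of_ne_of_ne hfy (by rw [hfx]; simp), hfx]

theorem exists_equiv_fin_zero {α : Type*} [Fintype α] {a : ℕ} (h : Fintype.card α = a) (x : α) :
    ∃ e : α ≃ Fin a, (e x).val = 0 := by
  have ha : 0 < a := h ▸ Fintype.card_pos_iff.2 ⟨x⟩
  let e₀ : α ≃ Fin a := Fintype.equivFinOfCardEq h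
  exact ⟨e₀.trans (Equiv.swap (e₀ x) ⟨0, ha⟩), by simp⟩

theorem exists_equiv_sum_fin {V : Type*} [Fintype V] [DecidableEq V] {A : Finset V} {a b : ℕ}
    (ha : #A = a) (hb : #Aᶜ = b) {x y z : V} (hx : x ∈ A) (hy : y ∈ A) (hxy : x ≠ y)
    (hz : z ∉ A) :
    ∃ e : V ≃ Fin a ⊕ Fin b,
      (∀ i ∈ A, ∃ k : Fin a, e i = Sum.inl k ∧ (k.val = 0 ↔ i = x) ∧ (k.val = 1 ↔ i = y)) ∧
      ∀ i ∉ A, ∃ k : Fin b, e i = Sum.inr k ∧ (k.val = 0 ↔ i = z) := by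
  obtain ⟨e₁, h1, h2⟩ := exists_equiv_fin_of_ne (α := {i // i ∈ A}) (a := a) (by simp [ha])
    (x := ⟨x, hx⟩) (y := ⟨y, hy⟩) (by simpa using hxy)
  obtain ⟨e₂, h3⟩ := exists_equiv_fin_zero (α := {i // i ∉ A}) (a := b)
    (by rw [Fintype.card_subtype, ← hb]; congr 1; ext; simp) ⟨z, hz⟩
  refine ⟨(Equiv.sumCompl (· ∈ A)).symm.trans (Equiv.sumCongr e₁ e₂), ?_, ?_⟩
  · intro i hi
    refine ⟨e₁ ⟨i, hi⟩, ?_, ?_, ?_⟩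
    · rw [Equiv.trans_apply, Equiv.sumCompl_symm_apply_of_pos hi]
      rfl
    · rw [← h1, Fin.val_inj, e₁.apply_eq_iff_eq, Subtype.mk.injEq]
    · rw [← h2, Fin.val_inj, e₁.apply_eq_iff_eq, Subtype.mk.injEq]
  · intro i hi
    refine ⟨e₂ ⟨i, hi⟩, ?_, ?_⟩
    · rw [Equiv.trans_apply, Equiv.sumCompl_symm_apply_of_neg hi]
      rfl
    · rw [← h3, Fin.val_inj, e₂.apply_eq_iff_eq, Subtype.mk.injEq]

theorem nonempty_iso_bipartitePlus {V : Type*} [Fintype V] [DecidableEq V] {G : SimpleGraph V}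
    {A : Finset V} {a b : ℕ} (ha : #A = a) (hb : #Aᶜ = b) {x y z : V} (hx : x ∈ A) (hy : y ∈ A)
    (hxy : x ≠ y) (hz : z ∉ A)
    (hA : ∀ i ∈ A, ∀ j ∈ A, (G.Adj i j ↔ (i = x ∧ j = y) ∨ (i = y ∧ j = x)))
    (hB : ∀ i ∉ A, ∀ j ∉ A, ¬ G.Adj i j) (hAB : ∀ i ∈ A, ∀ j ∉ A, G.Adj i j) :
    Nonempty (G ≃g bipartitePlus a b) := by
  obtain ⟨e, h1, h2⟩ := exists_equiv_sum_fin ha hb hx hy hxy hz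
  refine ⟨⟨e, fun {i j} => ?_⟩⟩
  by_cases hi : i ∈ A <;> by_cases hj : j ∈ A
  · obtain ⟨k, hk, hk0, hk1⟩ := h1 i hi
    obtain ⟨m, hm, hm0, hm1⟩ := h1 j hj
    rw [hk, hm, bipartitePlus_adj_inl_inl, hA i hi j hj, hk0, hk1, hm0, hm1]
  · obtain ⟨k, hk, -⟩ := h1 i hi
    obtain ⟨m, hm, -⟩ := h2 j hj
    rw [hk, hm]
    exact iff_of_true (bipartitePlus_adj_inl_inr k m) (hAB i hi j hj)
  · obtain ⟨k, hk, -⟩ := h2 i hi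
    obtain ⟨m, hm, -⟩ := h1 j hj
    rw [hk, hm]
    exact iff_of_true (bipartitePlus_adj_inl_inr m k).symm (hAB j hj i hi).symm
  · obtain ⟨k, hk, -⟩ := h2 i hi
    obtain ⟨m, hm, -⟩ := h2 j hj
    rw [hk, hm]
    exact iff_of_false (bipartitePlus_not_adj_inr_inr k m) (hB i hi j hj)

theorem nonempty_iso_bipartitePlusMinus {V : Type*} [Fintype V] [DecidableEq V]
    {G : SimpleGraph V} {A : Finset V} {a b : ℕ} (ha : #A = a) (hb : #Aᶜ = b) {x y z : V}
    (hx : x ∈ A) (hy : y ∈ A) (hxy : x ≠ y) (hz : z ∉ A)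
    (hA : ∀ i ∈ A, ∀ j ∈ A, (G.Adj i j ↔ (i = x ∧ j = y) ∨ (i = y ∧ j = x)))
    (hB : ∀ i ∉ A, ∀ j ∉ A, ¬ G.Adj i j)
    (hAB : ∀ i ∈ A, ∀ j ∉ A, (G.Adj i j ↔ ¬ (i = x ∧ j = z))) :
    Nonempty (G ≃g bipartitePlusMinus a b) := by
  obtain ⟨e, h1, h2⟩ := exists_equiv_sum_fin ha hb hx hy hxy hz
  refine ⟨⟨e, fun {i j} => ?_⟩⟩
  by_cases hi : i ∈ A <;> by_cases hj : j ∈ A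
  · obtain ⟨k, hk, hk0, hk1⟩ := h1 i hi
    obtain ⟨m, hm, hm0, hm1⟩ := h1 j hj
    rw [hk, hm, bipartitePlusMinus_adj_inl_inl, hA i hi j hj, hk0, hk1, hm0, hm1]
  · obtain ⟨k, hk, hk0, -⟩ := h1 i hi
    obtain ⟨m, hm, hm0⟩ := h2 j hj
    rw [hk, hm, bipartitePlusMinus_adj_inl_inr, hAB i hi j hj, hk0, hm0]
  · obtain ⟨k, hk, hk0⟩ := h2 i hi
    obtain ⟨m, hm, hm0, -⟩ := h1 j hj
    rw [hk, hm, SimpleGraph.adj_comm, bipartitePlusMinus_adj_inl_inr, G.adj_comm, hAB j hj i hi,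
      hk0, hm0]
  · obtain ⟨k, hk, -⟩ := h2 i hi
    obtain ⟨m, hm, -⟩ := h2 j hj
    rw [hk, hm]
    exact iff_of_false (bipartitePlusMinus_not_adj_inr_inr k m) (hB i hi j hj)

/-! ### Triangle and spectral bounds; the spectral radius of the Turán graph. -/

theorem card_common_le_triangleCount {V : Type*} [Fintype V] [DecidableEq V] (G : SimpleGraph V)
    [DecidableRel G.Adj] {x y : V} (hxy : G.Adj x y) {S : Finset V}
    (hS : ∀ z ∈ S, G.Adj x z ∧ G.Adj y z) : #S ≤ triangleCount G := by
  refine card_le_card_of_injOn (fun z => {x, y, z}) ?_ ?_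
  · intro z hz
    rw [mem_coe, SimpleGraph.mem_cliqueFinset_iff, SimpleGraph.is3Clique_iff]
    exact ⟨x, y, z, hxy, (hS z hz).1, (hS z hz).2, rfl⟩
  · intro z hz w hw h
    have h1 : z ∈ ({x, y, w} : Finset V) := by
      rw [← show ({x, y, z} : Finset V) = {x, y, w} from h]
      simp
    simp only [mem_insert, mem_singleton] at h1
    rcases h1 with rfl | rfl | h1
    · exact absurd rfl (hS _ hz).1.ne
    · exact absurd rfl (hS _ hz).2.ne
    · exact h1

theorem pow_three_le_of_perron {V : Type*} [Fintype V] [DecidableEq V] (G : SimpleGraph V)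
    [DecidableRel G.Adj] {l : ℝ} (hl : (l • (1 : Matrix V V ℝ) + G.adjMatrix ℝ).PosSemidef)
    {v : V → ℝ} (hv : v ≠ 0) (h : G.adjMatrix ℝ *ᵥ v = l • v) :
    l ^ 3 ≤ l * #G.edgeFinset + 3 * triangleCount G := by
  have h1 := two_mul_pow_three_le_trace (G.isHermitian_adjMatrix ℝ) hl hv h
  rw [trace_adjMatrix_sq, trace_adjMatrix_pow_three] at h1
  linarith

theorem le_adjSpectralRadius {V : Type*} [Fintype V] [DecidableEq V] (G : SimpleGraph V)
    [DecidableRel G.Adj] {k : ℝ} (w : V → ℝ) (hw : 0 < w ⬝ᵥ w)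
    (h : k * (w ⬝ᵥ w) ≤ w ⬝ᵥ (G.adjMatrix ℝ *ᵥ w)) : ENNReal.ofReal k ≤ adjSpectralRadius G := by
  have hV : Nonempty V := by
    by_contra hV
    rw [not_nonempty_iff] at hV
    simp [dotProduct] at hw
  obtain ⟨l, v, hl, hr, -, -, -, hs, -⟩ := exists_perron_vector G
  have h1 := hs.dotProduct_mulVec_nonneg w
  simp only [star_trivial, sub_mulVec, smul_mulVec, one_mulVec, dotProduct_sub,
        dotProduct_smul, smul_eq_mul] at h1
  rw [hr]
  exact ENNReal.ofReal_le_ofReal (le_of_mul_le_mul_right (by linarith) hw)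

theorem dotProduct_adjMatrix_mulVec {V : Type*} [Fintype V] (G : SimpleGraph V)
    [DecidableRel G.Adj] (w : V → ℝ) :
    w ⬝ᵥ (G.adjMatrix ℝ *ᵥ w) = ∑ i, ∑ j, G.adjMatrix ℝ i j * (w i * w j) := by
  simp only [dotProduct, mulVec, mul_sum]
  exact sum_congr rfl fun i _ => sum_congr rfl fun j _ => by ring

theorem card_edgeFinset_turanGraph_two {n h : ℕ} (hn : n = 2 * h ∨ n = 2 * h + 1) :
    #(SimpleGraph.turanGraph n 2).edgeFinset = h * (n - h) := by
  rw [SimpleGraph.card_edgeFinset_turanGraph]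
  rcases hn with rfl | rfl
  · have : 2 * h - h = h := by omega
    rw [this, Nat.mul_mod_right]
    have : (2 * h) ^ 2 = 4 * (h * h) := by ring
    simp [this]
  · have h1 : 2 * h + 1 - h = h + 1 := by omega
    have h2 : (2 * h + 1) % 2 = 1 := by omega
    have h3 : (2 * h + 1) ^ 2 - 1 ^ 2 = 4 * (h * (h + 1)) := by
      rw [show (2 * h + 1) ^ 2 = 4 * (h * (h + 1)) + 1 by ring]
      simp
    rw [h1, h2, h3]
    simp

theorem adjSpectralRadius_turanGraph_two {n h : ℕ} (hn : n = 2 * h ∨ n = 2 * h + 1) (hh : 0 < h) :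
    adjSpectralRadius (SimpleGraph.turanGraph n 2) = ENNReal.ofReal (√((h : ℝ) * (n - h))) := by
  set T := SimpleGraph.turanGraph n 2 with hT
  have hF : (#T.edgeFinset : ℝ) = h * (n - h) := by
    rw [card_edgeFinset_turanGraph_two hn, Nat.cast_mul, Nat.cast_sub (by omega)]
  have hF0 : (0 : ℝ) < h * (n - h) := by
    have : (h : ℝ) < n := by exact_mod_cast (by omega : h < n)
    have : (0 : ℝ) < h := by exact_mod_cast hh
    exact mul_pos this (by linarith)
  have : Nonempty (Fin n) := ⟨⟨0, by omega⟩⟩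
  apply le_antisymm
  · obtain ⟨l, v, hl, hr, hv, -, he, -, hs⟩ := exists_perron_vector T
    have h1 := pow_three_le_of_perron T hs hv he
    have ht : triangleCount T = 0 := by
      rw [triangleCount, card_eq_zero, SimpleGraph.cliqueFinset_eq_empty_iff]
      exact SimpleGraph.turanGraph_cliqueFree (by norm_num)
    rw [ht, hF] at h1
    rw [hr]
    apply ENNReal.ofReal_le_ofReal
    rcases hl.eq_or_lt with rfl | hl
    · exact Real.sqrt_nonneg _
    · apply Real.le_sqrt_of_sq_le
      apply le_of_mul_le_mul_left _ hl
      push_cast at h1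
      linarith
  · set A : Finset (Fin n) := univ.filter fun i => i.val % 2 = 0 with hA
    have hin : ∀ i ∈ A, ∀ j ∈ A, T.adjMatrix ℝ i j = 0 := by
      intro i hi j hj
      rw [adjMatrix_eq_zero_iff, hT, SimpleGraph.turanGraph_adj]
      simp only [hA, mem_filter, mem_univ, true_and] at hi hj
      omega
    have hout : ∀ i ∈ Aᶜ, ∀ j ∈ Aᶜ, T.adjMatrix ℝ i j = 0 := by
      intro i hi j hj
      rw [adjMatrix_eq_zero_iff, hT, SimpleGraph.turanGraph_adj]
      simp only [hA, mem_filter, mem_compl, mem_univ, true_and] at hi hj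
      omega
    have hcross : ∀ i ∈ A, ∀ j ∈ Aᶜ, T.adjMatrix ℝ i j = 1 := by
      intro i hi j hj
      rw [adjMatrix_eq_one_iff, hT, SimpleGraph.turanGraph_adj]
      simp only [hA, mem_filter, mem_compl, mem_univ, true_and] at hi hj
      omega
    have hab : (#A : ℝ) * #Aᶜ = h * (n - h) := by
      have h1 := sum_univ_eq_blocks (adjMatrix_symm T) A
      rw [sum_sum_adjMatrix, hF, sum_eq_zero fun i hi => sum_eq_zero fun j hj => hin i hi j hj,
        sum_eq_zero fun i hi => sum_eq_zero fun j hj => hout i hi j hj,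
        sum_eq_zero fun i hi => sum_eq_zero fun j hj => by rw [hcross i hi j hj, sub_self]] at h1
      linarith
    -- This is the Perron vector of the complete bipartite graph, so the Rayleigh quotient is exact.
    set w : Fin n → ℝ := fun i => if i ∈ A then √(#Aᶜ : ℝ) else √(#A : ℝ) with hw
    have hwA : ∀ i ∈ A, w i = √(#Aᶜ : ℝ) := fun i hi => by simp [hw, hi]
    have hwB : ∀ i ∈ Aᶜ, w i = √(#A : ℝ) := fun i hi => by simp [hw, mem_compl.1 hi]
    have hww : w ⬝ᵥ w = 2 * (#A * #Aᶜ) := by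
      rw [dotProduct, ← sum_add_sum_compl A, sum_congr rfl fun i hi => by rw [hwA i hi],
        sum_congr (s₁ := Aᶜ) rfl fun i hi => by rw [hwB i hi]]
      simp only [sum_const, nsmul_eq_mul, Real.mul_self_sqrt (Nat.cast_nonneg _)]
      ring
    refine le_adjSpectralRadius T w (by rw [hww, hab]; linarith) (le_of_eq ?_)
    have hq := sum_univ_eq_blocks (a := fun i j => T.adjMatrix ℝ i j * (w i * w j))
      (fun i j => by rw [adjMatrix_symm, mul_comm (w i)]) A
    rw [hww, dotProduct_adjMatrix_mulVec, hq,
      sum_eq_zero fun i hi => sum_eq_zero fun j hj => by rw [hin i hi j hj, zero_mul],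
      sum_eq_zero fun i hi => sum_eq_zero fun j hj => by rw [hout i hi j hj, zero_mul],
      sum_congr rfl fun i hi => sum_congr rfl fun j hj => by
        rw [hcross i hi j hj, hwA i hi, hwB j hj]]
    simp only [sum_const, nsmul_eq_mul]
    rw [mul_comm (√(#Aᶜ : ℝ)), ← Real.sqrt_mul (Nat.cast_nonneg _), hab]
    linear_combination (-(2 * (√((h : ℝ) * (n - h)) - 1))) * hab

/-! ### Few triangles and a large spectral radius force an extremal graph. -/

theorem exists_unique_missing_of_sum_eq_one {V : Type*} {a : V → V → ℝ}
    (h01 : ∀ x y, a x y = 0 ∨ a x y = 1) {A B : Finset V}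
    (h : ∑ i ∈ A, ∑ j ∈ B, (1 - a i j) = 1) :
    ∃ x ∈ A, ∃ z ∈ B, ∀ i ∈ A, ∀ j ∈ B, (a i j = 1 ↔ ¬ (i = x ∧ j = z)) := by
  classical
  have h0 : ∀ p : V × V, 0 ≤ 1 - a p.1 p.2 := fun p => by
    rcases h01 p.1 p.2 with h | h <;> simp [h]
  replace h : ∑ p ∈ A ×ˢ B, (1 - a p.1 p.2) = 1 := by rwa [sum_product]
  obtain ⟨⟨x, z⟩, hxz, hne⟩ := exists_ne_zero_of_sum_ne_zero (by rw [h]; norm_num)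
  obtain ⟨hx, hz⟩ := mem_product.1 hxz
  have hxz0 : a x z = 0 := (h01 x z).resolve_right fun h => hne (by simp [h])
  refine ⟨x, hx, z, hz, fun i hi j hj => ⟨?_, fun hc => ?_⟩⟩
  · rintro h1 ⟨rfl, rfl⟩
    rw [h1] at hxz0
    norm_num at hxz0
  · refine (h01 i j).resolve_left fun h1 => ?_
    have hsub : ({(x, z), (i, j)} : Finset (V × V)) ⊆ A ×ˢ B := by
      intro p hp
      simp only [mem_insert, mem_singleton] at hp
      rcases hp with rfl | rfl <;> simp [*]
    have h2 := sum_le_sum_of_subset_of_nonneg (f := fun p : V × V => 1 - a p.1 p.2) hsub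
      fun p _ _ => h0 p
    rw [h, sum_pair, hxz0, h1] at h2
    · norm_num at h2
    · rintro h3
      rw [Prod.mk.injEq] at h3
      exact hc ⟨h3.1.symm, h3.2.symm⟩

theorem balanced_deficit_cases {h e j : ℤ} (he : e = 0 ∨ e = 1)
    (hK : h * (h + e) - (h + e - j) * (h + j) ≤ 3) : -2 + e ≤ j ∧ j ≤ 2 := by
  have hK' : j * (j - e) ≤ 3 := by linarith
  rcases he with rfl | rfl <;> constructor <;> by_contra! hc <;> nlinarith

theorem mul_sub_nonneg_of_zero_or_one {j e : ℤ} (he : e = 0 ∨ e = 1) : 0 ≤ j * (j - e) := by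
  rcases he with rfl | rfl
  · rw [sub_zero]
    exact mul_self_nonneg j
  · rcases le_or_gt j 0 with h | h
    · exact mul_nonneg_of_nonpos_of_nonpos h (by omega)
    · exact mul_nonneg (by omega) (by omega)

theorem eq_neg_one_of_mul_sub_lt {j e : ℤ} (he : 0 ≤ e) (hj : j < 0) (h : j * (j - e) < 3) :
    j = -1 := by
  by_contra hc
  have : j ≤ -2 := by omega
  nlinarith

theorem eq_zero_of_mul_sub_lt {j e : ℤ} (he : 0 ≤ e) (hj : j ≤ 0) (h : j * (j - e) < 1) :
    j = 0 := by
  by_contra hc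
  have : j ≤ -1 := by omega
  nlinarith

theorem isTriangleExtremal_of_one_inside_edge {V : Type*} [Fintype V] [DecidableEq V]
    (G : SimpleGraph V) [DecidableRel G.Adj] {n h : ℕ} (hV : Fintype.card V = n)
    (hn : n = 2 * h ∨ n = 2 * h + 1) (hh : 18 ≤ h) (hm : h * (n - h) ≤ #G.edgeFinset + 2)
    (ht : triangleCount G + 1 ≤ h) {l : ℝ} (hl : 0 ≤ l) (hlF : (h : ℝ) * (n - h) ≤ l ^ 2)
    {v : V → ℝ} (hv : v ≠ 0) (hv0 : ∀ i, 0 ≤ v i) (he : G.adjMatrix ℝ *ᵥ v = l • v)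
    {A : Finset V} (hA : ∑ x ∈ A, ∑ y ∈ A, G.adjMatrix ℝ x y = 2)
    (hB : ∑ x ∈ Aᶜ, ∑ y ∈ Aᶜ, G.adjMatrix ℝ x y = 0) : IsTriangleExtremal n G := by
  obtain ⟨x, hx, y, hy, hxy, hAe⟩ := exists_unique_edge_of_sum_eq_two G hA
  have hadj : G.Adj x y := (hAe x hx y hy).2 (Or.inl ⟨rfl, rfl⟩)
  have hBe : ∀ i ∉ A, ∀ j ∉ A, ¬ G.Adj i j := fun i hi j hj =>
    not_adj_of_sum_eq_zero G hB (mem_compl.2 hi) (mem_compl.2 hj)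
  have hblocks := sum_univ_eq_blocks (adjMatrix_symm G) A
  rw [sum_sum_adjMatrix, hA, hB] at hblocks
  set q' := ∑ i ∈ A, ∑ j ∈ Aᶜ, (1 - G.adjMatrix ℝ i j) with hq'
  have hq0 : 0 ≤ q' := sum_nonneg fun i _ => sum_nonneg fun j _ => by
    rcases adjMatrix_eq_zero_or_one G i j with h | h <;> rw [h] <;> norm_num
  have hle : #G.edgeFinset ≤ #A * #Aᶜ + 1 := by
    have : (#G.edgeFinset : ℝ) ≤ #A * #Aᶜ + 1 := by linarith
    exact_mod_cast this
  obtain ⟨q, hq⟩ : ∃ q : ℕ, #G.edgeFinset + q = #A * #Aᶜ + 1 := Nat.le.dest hle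
  have hqq : q' = q := by
    have : (#G.edgeFinset : ℝ) + q = #A * #Aᶜ + 1 := by exact_mod_cast hq
    linarith
  have hcardn : #A + #Aᶜ = n := by rw [card_add_card_compl, hV]
  have hmiss := card_sub_missing_le_common (adjMatrix_eq_zero_or_one G) hx hy hxy
  set N : Finset V := Aᶜ.filter fun z => G.Adj x z ∧ G.Adj y z with hN
  have hNt : #N ≤ triangleCount G :=
    card_common_le_triangleCount G hadj fun z hz => (mem_filter.1 hz).2
  have hNc : ∑ z ∈ Aᶜ, G.adjMatrix ℝ x z * G.adjMatrix ℝ y z = #N := by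
    rw [hN, card_filter, Nat.cast_sum]
    refine sum_congr rfl fun z _ => ?_
    by_cases h1 : G.Adj x z <;> by_cases h2 : G.Adj y z <;> simp [h1, h2]
  -- With |Aᶜ| = h + j and t ≤ h - 1 this reads j ≤ q - 1, which fixes the sign of j in the cases q
  -- = 0 and q = 1.
  have hbq : #Aᶜ ≤ triangleCount G + q := by
    have : (#Aᶜ : ℝ) ≤ #N + q := by
      rw [← hNc, ← hqq]
      linarith
    have : #Aᶜ ≤ #N + q := by exact_mod_cast this
    omega
  obtain ⟨e, he01, hne⟩ : ∃ e : ℕ, (e = 0 ∨ e = 1) ∧ n = 2 * h + e := by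
    rcases hn with h | h
    · exact ⟨0, Or.inl rfl, h⟩
    · exact ⟨1, Or.inr rfl, h⟩
  have hnh : n - h = h + e := by omega
  rw [hnh] at hm
  have hnhr : (n : ℝ) - h = h + e := by rw [hne]; push_cast; ring
  rw [hnhr] at hlF
  obtain ⟨j, hj⟩ : ∃ j : ℤ, (#Aᶜ : ℤ) = h + j := ⟨#Aᶜ - h, by ring⟩
  have hjA : (#A : ℤ) = h + e - j := by omega
  have hK3 : (h : ℤ) * (h + e) - (h + e - j) * (h + j) + q ≤ 3 := by
    rw [← hj, ← hjA]
    have h1 : (h : ℤ) * (h + e) ≤ #G.edgeFinset + 2 := by exact_mod_cast hm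
    have h2 : (#G.edgeFinset : ℤ) + q = #A * #Aᶜ + 1 := by exact_mod_cast hq
    linarith
  have hjb := balanced_deficit_cases (h := h) (e := e) (j := j) (by omega) (by omega)
  have hhr : (18 : ℝ) ≤ h := by exact_mod_cast hh
  have her : (0 : ℝ) ≤ e := by positivity
  have hlh : (h : ℝ) ≤ l := by
    refine le_of_sq_le_sq ?_ hl
    nlinarith
  have hAl : (#A : ℝ) ≤ l + 2 := by
    have : (#A : ℤ) ≤ h + 2 := by omega
    have : (#A : ℝ) ≤ h + 2 := by exact_mod_cast this
    linarith
  have hBl : (#Aᶜ : ℝ) ≤ l + 2 := by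
    have : (#Aᶜ : ℤ) ≤ h + 2 := by omega
    have : (#Aᶜ : ℝ) ≤ h + 2 := by exact_mod_cast this
    linarith
  -- Here e is the parity of n, and j(j - e) is the loss of cross pairs against the balanced
  -- partition.
  have hKeq : (h : ℝ) * (h + e) - #A * #Aᶜ = ((j * (j - e) : ℤ) : ℝ) := by
    have : (h : ℤ) * (h + e) - #A * #Aᶜ = j * (j - e) := by rw [hj, hjA]; ring
    exact_mod_cast this
  have hKq : j * (j - e) + q ≤ 3 := by linarith
  have hperron := perron_bound (adjMatrix_symm G) (adjMatrix_eq_zero_or_one G) hx hy hxy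
    (fun i hi j hj => by simp only [SimpleGraph.adjMatrix_apply, hAe i hi j hj])
    (fun i hi j hj => (adjMatrix_eq_zero_iff G).2 (hBe i (mem_compl.1 hi) j (mem_compl.1 hj)))
    (hq'.symm.trans hqq) (by linarith : 1 < l) hv hv0 (fun i => congrFun he i)
  have hP := (mul_le_mul_of_nonneg_right (by linarith : ((j * (j - e) : ℤ) : ℝ) ≤
    l ^ 2 - #A * #Aᶜ) (mul_nonneg (by positivity) (by linarith) : 0 ≤ l ^ 2 * (l - 1))).trans hperron
  have hK0 : 0 ≤ j * (j - e) := mul_sub_nonneg_of_zero_or_one (by omega)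
  by_cases hbig : 3 ≤ 2 * (q : ℤ) + j * (j - e)
  · exfalso
    refine perron_bound_contradiction (by linarith) hAl hBl ?_ hP
    have hc : (q = 0 ∧ 3 ≤ j * (j - e)) ∨ (q = 1 ∧ 1 ≤ j * (j - e)) ∨ (q = 2 ∧ 0 ≤ j * (j - e)) ∨
      (q = 3 ∧ 0 ≤ j * (j - e)) := by omega
    exact_mod_cast hc
  push Not at hbig
  have hq1 : q = 0 ∨ q = 1 := by omega
  rcases hq1 with rfl | rfl
  · have hjneg : j < 0 := by omega
    have hfull : ∀ i ∈ A, ∀ j ∉ A, G.Adj i j := by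
      intro i hi j hj
      have h0 : ∀ i j, 0 ≤ 1 - G.adjMatrix ℝ i j := fun i j => by
        rcases adjMatrix_eq_zero_or_one G i j with h | h <;> rw [h] <;> norm_num
      rw [hq', Nat.cast_zero, sum_eq_zero_iff_of_nonneg
        fun i _ => sum_nonneg fun j _ => h0 i j] at hqq
      have := (sum_eq_zero_iff_of_nonneg fun j _ => h0 i j).1 (hqq i hi) j (mem_compl.2 hj)
      exact (adjMatrix_eq_one_iff G).1 (by linarith)
    obtain rfl : j = -1 := eq_neg_one_of_mul_sub_lt (e := e) (by omega) hjneg (by omega)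
    rcases he01 with rfl | rfl
    · obtain ⟨z, hz⟩ : Aᶜ.Nonempty := card_pos.1 (by omega)
      refine Or.inl ⟨⟨h, by omega⟩, Or.inl ?_⟩
      exact nonempty_iso_bipartitePlus (by omega) (by omega) hx hy hxy (mem_compl.1 hz) hAe hBe
        hfull
    -- For odd n the loss is 2, which the leading-order bound K + 2q ≤ 2 still allows. The exact
    -- size h - 1 of the complement in the spectral bound gives l ≤ h, against l² ≥ h(h + 1).
    · exfalso
      have hb : (#Aᶜ : ℝ) = h - 1 := by
        have : (#Aᶜ : ℤ) = h - 1 := by omega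
        exact_mod_cast this
      rw [hb] at hP
      push_cast at hP hlF
      have h1 : (l - 1) * (2 * l ^ 2) ≤ (h - 1) * (2 * l ^ 2) := by linarith
      have h2 : l - 1 ≤ h - 1 := le_of_mul_le_mul_right h1 (by nlinarith)
      nlinarith
  · obtain rfl : j = 0 := eq_zero_of_mul_sub_lt (e := e) (by omega) (by omega) (by omega)
    obtain ⟨x₀, hx₀, z, hz, hmissing⟩ := exists_unique_missing_of_sum_eq_one
      (adjMatrix_eq_zero_or_one G) (hq'.symm.trans (hqq.trans Nat.cast_one))
    have hAB : ∀ i ∈ A, ∀ j ∉ A, (G.Adj i j ↔ ¬ (i = x₀ ∧ j = z)) := fun i hi j hj => by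
      rw [← adjMatrix_eq_one_iff]
      exact hmissing i hi j (mem_compl.2 hj)
    -- If the missing edge avoided x and y, all h vertices of the complement would form triangles
    -- with xy.
    have hx₀xy : x₀ = x ∨ x₀ = y := by
      by_contra! hc
      have : N = Aᶜ := by
        rw [hN, filter_eq_self]
        intro w hw
        exact ⟨(hAB x hx w (mem_compl.1 hw)).2 fun h => hc.1 h.1.symm,
          (hAB y hy w (mem_compl.1 hw)).2 fun h => hc.2 h.1.symm⟩
      rw [this] at hNt
      omega
    have key : ∀ a b : ℕ, #A = a → #Aᶜ = b → Nonempty (G ≃g bipartitePlusMinus a b) := by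
      intro a b ha hb
      rcases hx₀xy with rfl | rfl
      · exact nonempty_iso_bipartitePlusMinus ha hb hx hy hxy (mem_compl.1 hz) hAe hBe hAB
      · exact nonempty_iso_bipartitePlusMinus ha hb hy hx hxy.symm (mem_compl.1 hz)
          (fun i hi j hj => by rw [hAe i hi j hj, or_comm]) hBe hAB
    rcases he01 with rfl | rfl
    · exact Or.inl ⟨⟨h, by omega⟩, Or.inr (key _ _ (by omega) (by omega))⟩
    · exact Or.inr ⟨⟨h, by omega⟩, key _ _ (by omega) (by omega)⟩

theorem isTriangleExtremal_of_triangleCount_lt {V : Type*} [Fintype V] [DecidableEq V]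
    (G : SimpleGraph V) [DecidableRel G.Adj] {n : ℕ} (hV : Fintype.card V = n) (hn : 36 ≤ n)
    (hr : adjSpectralRadius (SimpleGraph.turanGraph n 2) ≤ adjSpectralRadius G)
    (hiso : ¬ Nonempty (G ≃g SimpleGraph.turanGraph n 2)) (ht : triangleCount G + 1 ≤ n / 2) :
    IsTriangleExtremal n G := by
  obtain ⟨h, hh⟩ : ∃ h, h = n / 2 := ⟨_, rfl⟩
  rw [← hh] at ht
  have hn2 : n = 2 * h ∨ n = 2 * h + 1 := by omega
  have : Nonempty V := Fintype.card_pos_iff.1 (by omega)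
  obtain ⟨l, v, hl, hrl, hv, hv0, he, -, hs⟩ := exists_perron_vector G
  rw [adjSpectralRadius_turanGraph_two hn2 (by omega), hrl, ENNReal.ofReal_le_ofReal_iff hl] at hr
  have hlF : (h : ℝ) * (n - h) ≤ l ^ 2 := (Real.sqrt_le_left hl).1 hr
  have hnr : (h : ℝ) ≤ n - h := by
    have : ((h + h : ℕ) : ℝ) ≤ n := by exact_mod_cast (by omega : h + h ≤ n)
    push_cast at this
    linarith
  have hhr : (18 : ℝ) ≤ h := by exact_mod_cast (by omega : 18 ≤ h)
  have hlh : (h : ℝ) ≤ l := by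
    refine le_of_sq_le_sq ?_ hl
    nlinarith
  have hcube := pow_three_le_of_perron G hs hv he
  have htr : (triangleCount G : ℝ) + 1 ≤ h := by exact_mod_cast ht
  have hFr : ((h * (n - h) : ℕ) : ℝ) = h * (n - h) := by
    rw [Nat.cast_mul, Nat.cast_sub (by omega)]
  have hm : h * (n - h) ≤ #G.edgeFinset + 2 := by
    -- The triangle term satisfies 3t < 3h ≤ 3l.
    have h1 : l * l ^ 2 < l * (#G.edgeFinset + 3) := by nlinarith
    have h2 := lt_of_mul_lt_mul_left h1 hl
    have h3 : ((h * (n - h) : ℕ) : ℝ) < ((#G.edgeFinset + 3 : ℕ) : ℝ) := by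
      rw [hFr]
      push_cast
      linarith
    have := Nat.cast_lt.1 h3
    omega
  obtain ⟨A, hA | hA, hB⟩ := exists_partition G hV hn2 (by omega) hm ht
  · exfalso
    have hfree : G.CliqueFree 3 := by
      intro s hs
      obtain ⟨a, b, c, hab, hac, hbc, -⟩ := SimpleGraph.is3Clique_iff.1 hs
      have hAn : ∀ i j, G.Adj i j → (i ∈ A ↔ j ∉ A) := by
        intro i j hij
        by_cases hi : i ∈ A <;> by_cases hj : j ∈ A
        · exact absurd hij (not_adj_of_sum_eq_zero G hA hi hj)
        · simp [hi, hj]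
        · simp [hi, hj]
        · exact absurd hij (not_adj_of_sum_eq_zero G hB (mem_compl.2 hi) (mem_compl.2 hj))
      have := hAn a b hab
      have := hAn a c hac
      have := hAn b c hbc
      tauto
    have ht0 : triangleCount G = 0 := by
      rw [triangleCount, card_eq_zero, SimpleGraph.cliqueFinset_eq_empty_iff]
      exact hfree
    rw [ht0, Nat.cast_zero, mul_zero, add_zero] at hcube
    have h1 : l ^ 2 ≤ #G.edgeFinset :=
      le_of_mul_le_mul_left (by linarith) (by linarith : 0 < l)
    have hge : h * (n - h) ≤ #G.edgeFinset := by
      have : ((h * (n - h) : ℕ) : ℝ) ≤ #G.edgeFinset := by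
        rw [hFr]
        linarith
      exact_mod_cast this
    apply hiso
    rw [← hV, ← SimpleGraph.isTuranMaximal_iff_nonempty_iso_turanGraph (by norm_num)]
    refine ⟨hfree, fun H _ hH => ?_⟩
    refine hH.card_edgeFinset_le.trans ?_
    rw [← SimpleGraph.card_edgeFinset_turanGraph, hV, card_edgeFinset_turanGraph_two hn2]
    exact hge
  · exact isTriangleExtremal_of_one_inside_edge G hV hn2 (by omega) hm ht hl hlF hv hv0 he hA hB

/-! ### The extremal graphs: triangle count and spectral radius. -/

/-- Two vertices of any triangle lie in the same part, so every triangle contains the edge xy. -/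
theorem triangleCount_eq_card_common {V : Type*} [Fintype V] [DecidableEq V] (G : SimpleGraph V)
    [DecidableRel G.Adj] {A : Finset V} {x y : V} (hxy : G.Adj x y)
    (hA : ∀ i ∈ A, ∀ j ∈ A, (G.Adj i j ↔ (i = x ∧ j = y) ∨ (i = y ∧ j = x)))
    (hB : ∀ i ∉ A, ∀ j ∉ A, ¬ G.Adj i j) :
    triangleCount G = #{z | G.Adj x z ∧ G.Adj y z} := by
  apply le_antisymm
  · refine (card_le_card ?_).trans (card_image_le (f := fun z => ({x, y, z} : Finset V)))
    intro s hs
    rw [SimpleGraph.mem_cliqueFinset_iff, SimpleGraph.is3Clique_iff] at hs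
    obtain ⟨a, b, c, hab, hac, hbc, rfl⟩ := hs
    have key : ∀ a b c, G.Adj a b → G.Adj a c → G.Adj b c → a ∈ A → b ∈ A →
        ∃ z, (G.Adj x z ∧ G.Adj y z) ∧ ({x, y, z} : Finset V) = {a, b, c} := by
      intro a b c hab hac hbc ha hb
      rcases (hA a ha b hb).1 hab with ⟨rfl, rfl⟩ | ⟨rfl, rfl⟩
      · exact ⟨c, ⟨hac, hbc⟩, rfl⟩
      · exact ⟨c, ⟨hbc, hac⟩, by ext; simp only [mem_insert]; tauto⟩
    simp only [mem_image, mem_filter, mem_univ, true_and]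
    by_cases ha : a ∈ A <;> by_cases hb : b ∈ A <;> by_cases hc : c ∈ A
    · exact key a b c hab hac hbc ha hb
    · exact key a b c hab hac hbc ha hb
    · obtain ⟨z, hz, h⟩ := key a c b hac hab hbc.symm ha hc
      exact ⟨z, hz, by rw [h]; ext; simp only [mem_insert, mem_singleton]; tauto⟩
    · exact absurd hbc (hB b hb c hc)
    · obtain ⟨z, hz, h⟩ := key b c a hbc hab.symm hac.symm hb hc
      exact ⟨z, hz, by rw [h]; ext; simp only [mem_insert, mem_singleton]; tauto⟩
    · exact absurd hac (hB a ha c hc)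
    · exact absurd hab (hB a ha b hb)
    · exact absurd hab (hB a ha b hb)
  · exact card_common_le_triangleCount G hxy fun z hz => (mem_filter.1 hz).2

theorem quadraticForm_of_one_inside_edge {V : Type*} [Fintype V] [DecidableEq V]
    (G : SimpleGraph V) [DecidableRel G.Adj] {A : Finset V} {x y : V} (hx : x ∈ A) (hy : y ∈ A)
    (hxy : x ≠ y) (hA : ∀ i ∈ A, ∀ j ∈ A, (G.Adj i j ↔ (i = x ∧ j = y) ∨ (i = y ∧ j = x)))
    (hB : ∀ i ∉ A, ∀ j ∉ A, ¬ G.Adj i j) (w : V → ℝ) :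
    w ⬝ᵥ (G.adjMatrix ℝ *ᵥ w) =
      2 * (w x * w y) + 2 * ∑ i ∈ A, ∑ j ∈ Aᶜ, G.adjMatrix ℝ i j * (w i * w j) := by
  have h1 : ∑ i ∈ A, ∑ j ∈ A, G.adjMatrix ℝ i j * (w i * w j) = 2 * (w x * w y) := by
    rw [← sum_product' A A fun i j => G.adjMatrix ℝ i j * (w i * w j),
      ← sum_subset (s₁ := {(x, y), (y, x)}), sum_pair]
    · simp only [SimpleGraph.adjMatrix_apply, hA x hx y hy, hA y hy x hx]
      simp
      ring
    · simp [hxy]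
    · intro p hp
      simp only [mem_insert, mem_singleton] at hp
      rcases hp with rfl | rfl <;> simp [*]
    · rintro ⟨i, j⟩ hij hp
      obtain ⟨hi, hj⟩ := mem_product.1 hij
      simp only [mem_insert, mem_singleton, Prod.mk.injEq] at hp
      simp only
      rw [(adjMatrix_eq_zero_iff G).2 (by rwa [hA i hi j hj]), zero_mul]
  have h2 : ∑ i ∈ Aᶜ, ∑ j ∈ Aᶜ, G.adjMatrix ℝ i j * (w i * w j) = 0 :=
    sum_eq_zero fun i hi => sum_eq_zero fun j hj => by
      rw [(adjMatrix_eq_zero_iff G).2 (hB i (mem_compl.1 hi) j (mem_compl.1 hj)), zero_mul]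
  have h3 := sum_univ_eq_blocks (a := fun i j => G.adjMatrix ℝ i j * (w i * w j))
    (fun i j => by rw [adjMatrix_symm, mul_comm (w i)]) A
  rw [dotProduct_adjMatrix_mulVec, h3, h1, h2]
  simp [sum_sub_distrib]

theorem lt_adjSpectralRadius_of_plus {V : Type*} [Fintype V] [DecidableEq V] (G : SimpleGraph V)
    [DecidableRel G.Adj] {A : Finset V} {x y : V} (hx : x ∈ A) (hy : y ∈ A) (hxy : x ≠ y)
    (hA : ∀ i ∈ A, ∀ j ∈ A, (G.Adj i j ↔ (i = x ∧ j = y) ∨ (i = y ∧ j = x)))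
    (hB : ∀ i ∉ A, ∀ j ∉ A, ¬ G.Adj i j) (hAB : ∀ i ∈ A, ∀ j ∉ A, G.Adj i j) {p : ℝ} (hp : 1 < p)
    (ha : (#A : ℝ) = p + 1) (hb : (#Aᶜ : ℝ) = p - 1) :
    ENNReal.ofReal p < adjSpectralRadius G := by
  -- With these weights the quadratic form exceeds p times the squared norm by p² - p.
  set w : V → ℝ := fun i => if i ∈ A then p else p + 1 with hw
  have hwA : ∀ i ∈ A, w i = p := fun i hi => by simp [hw, hi]
  have hwB : ∀ i ∈ Aᶜ, w i = p + 1 := fun i hi => by simp [hw, mem_compl.1 hi]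
  apply lt_adjSpectralRadius G (by linarith) w
  rw [quadraticForm_of_one_inside_edge G hx hy hxy hA hB, dotProduct, ← sum_add_sum_compl A,
    sum_congr rfl fun i hi => by rw [hwA i hi],
    sum_congr (s₁ := Aᶜ) rfl fun i hi => by rw [hwB i hi],
    sum_congr rfl fun i hi => sum_congr rfl fun j hj => by
      rw [(adjMatrix_eq_one_iff G).2 (hAB i hi j (mem_compl.1 hj)), hwA i hi, hwB j hj],
    hwA x hx, hwA y hy]
  simp only [sum_const, nsmul_eq_mul, ha, hb]
  nlinarith

theorem lt_adjSpectralRadius_of_plusMinus {V : Type*} [Fintype V] [DecidableEq V]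
    (G : SimpleGraph V) [DecidableRel G.Adj] {A : Finset V} {x y z : V} (hx : x ∈ A) (hy : y ∈ A)
    (hxy : x ≠ y) (hz : z ∉ A)
    (hA : ∀ i ∈ A, ∀ j ∈ A, (G.Adj i j ↔ (i = x ∧ j = y) ∨ (i = y ∧ j = x)))
    (hB : ∀ i ∉ A, ∀ j ∉ A, ¬ G.Adj i j)
    (hAB : ∀ i ∈ A, ∀ j ∉ A, (G.Adj i j ↔ ¬ (i = x ∧ j = z))) {k : ℝ} (hk : 0 < k)
    (hab : k ^ 2 = #A * #Aᶜ) (hb : k ^ 2 + k < #Aᶜ * (k + 2)) :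
    ENNReal.ofReal k < adjSpectralRadius G := by
  set a : ℝ := (#A : ℝ) with ha
  set b : ℝ := (#Aᶜ : ℝ) with hbd
  have hb0 : 0 < b := by
    by_contra! h
    have : b * (k + 2) ≤ 0 := mul_nonpos_of_nonpos_of_nonneg h (by linarith)
    nlinarith
  set g := k / b with hg
  set s := 1 / (k + 1) with hs
  have hgb : b * g = k := by rw [hg]; field_simp
  have hgk : k * g = a := by
    rw [hg]
    field_simp
    linarith
  have hsk : (k + 1) * s = 1 := by rw [hs]; field_simp
  -- The Perron vector (1, g) of K_{a,b} alone gives excess 2(1 - g), which is zero when a = b.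
  -- Raising y and lowering z by s gives 2(1 - g + 2s - (k + 1)s²), maximal at s = 1/(k + 1) with
  -- value 2(1 - g + s). Hypothesis `hb` is equivalent to g < 1 + s.
  set w : V → ℝ := fun i => if i ∈ A then 1 + (if i = y then s else 0)
    else g - (if i = z then s else 0) with hw
  have hwA : ∀ i ∈ A, w i = 1 + (if i = y then s else 0) := fun i hi => by simp [hw, hi]
  have hwB : ∀ i ∈ Aᶜ, w i = g - (if i = z then s else 0) := fun i hi => by
    simp [hw, mem_compl.1 hi]
  have hSA : ∑ i ∈ A, w i = a + s := by
    rw [sum_congr rfl hwA, sum_add_distrib, sum_ite_eq' A y, if_pos hy]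
    simp [ha]
  have hSB : ∑ i ∈ Aᶜ, w i = k - s := by
    rw [sum_congr rfl hwB, sum_sub_distrib, sum_ite_eq' Aᶜ z, if_pos (mem_compl.2 hz), ← hgb]
    simp [hbd]
  have hSA2 : ∑ i ∈ A, w i * w i = a + 2 * s + s ^ 2 := by
    have : ∀ i ∈ A, w i * w i = 1 + (if i = y then 2 * s + s ^ 2 else 0) := by
      intro i hi
      rw [hwA i hi]
      split_ifs <;> ring
    rw [sum_congr rfl this, sum_add_distrib, sum_ite_eq' A y, if_pos hy]
    simp [ha]
    ring
  have hSB2 : ∑ i ∈ Aᶜ, w i * w i = b * g ^ 2 - 2 * g * s + s ^ 2 := by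
    have : ∀ i ∈ Aᶜ, w i * w i = g ^ 2 + (if i = z then -2 * g * s + s ^ 2 else 0) := by
      intro i hi
      rw [hwB i hi]
      split_ifs <;> ring
    rw [sum_congr rfl this, sum_add_distrib, sum_ite_eq' Aᶜ z, if_pos (mem_compl.2 hz)]
    simp [hbd]
    ring
  have hcross : ∑ i ∈ A, ∑ j ∈ Aᶜ, G.adjMatrix ℝ i j * (w i * w j) =
      (a + s) * (k - s) - w x * w z := by
    have h1 : ∀ i ∈ A, ∀ j ∈ Aᶜ, G.adjMatrix ℝ i j * (w i * w j) =
        w i * w j - if j = z then (if i = x then w x * w z else 0) else 0 := by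
      intro i hi j hj
      rw [SimpleGraph.adjMatrix_apply]
      simp only [hAB i hi j (mem_compl.1 hj)]
      by_cases h1 : i = x <;> by_cases h2 : j = z <;> simp [h1, h2]
    rw [sum_congr rfl fun i hi => sum_congr rfl (h1 i hi)]
    simp only [sum_sub_distrib]
    rw [← sum_mul_sum, hSA, hSB]
    simp [sum_ite_eq', mem_compl.2 hz, hx]
  apply lt_adjSpectralRadius G hk.le w
  have hwx : w x = 1 := by rw [hwA x hx]; simp [hxy]
  have hwy : w y = 1 + s := by rw [hwA y hy]; simp
  have hwz : w z = g - s := by rw [hwB z (mem_compl.2 hz)]; simp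
  rw [quadraticForm_of_one_inside_edge G hx hy hxy hA hB, hcross, hwx, hwy, hwz, dotProduct,
    ← sum_add_sum_compl A, hSA2, hSB2]
  have hfin : g < 1 + s := by
    rw [hg, hs, div_lt_iff₀ hb0]
    have : (1 + 1 / (k + 1)) * b = (b * (k + 2)) / (k + 1) := by field_simp; ring
    rw [this, lt_div_iff₀ (by linarith)]
    linarith
  have e1 : k * (b * g ^ 2) = k * a := by rw [sq, ← mul_assoc b, hgb, mul_comm k g, ← hgk]; ring
  have e2 : (k + 1) * s ^ 2 = s := by rw [sq, ← mul_assoc, hsk, one_mul]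
  have e3 : k * (2 * g * s) = 2 * a * s := by rw [← hgk]; ring
  nlinarith

theorem IsTriangleExtremal.triangleCount_and_lt {V : Type*} [Fintype V] [DecidableEq V]
    {G : SimpleGraph V} [DecidableRel G.Adj] {n : ℕ} (hn : 36 ≤ n) (hG : IsTriangleExtremal n G) :
    triangleCount G = n / 2 - 1 ∧
      adjSpectralRadius (SimpleGraph.turanGraph n 2) < adjSpectralRadius G := by
  classical
  have hmem : ∀ {a b : ℕ} (i : Fin a), (Sum.inl i : Fin a ⊕ Fin b) ∈
      (univ : Finset (Fin a)).map Function.Embedding.inl := by simp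
  have hnot : ∀ {a b : ℕ} (i : Fin b), (Sum.inr i : Fin a ⊕ Fin b) ∉
      (univ : Finset (Fin a)).map Function.Embedding.inl := by simp
  have hcardA : ∀ {a b : ℕ}, #((univ : Finset (Fin a)).map
      (Function.Embedding.inl : Fin a ↪ Fin a ⊕ Fin b)) = a := by simp
  have hcardB : ∀ {a b : ℕ}, #((univ : Finset (Fin a)).map
      (Function.Embedding.inl : Fin a ↪ Fin a ⊕ Fin b))ᶜ = b := by
    intro a b
    rw [card_compl, hcardA]
    simp
  have hne : ∀ {a b : ℕ} (ha : 2 ≤ a),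
      (Sum.inl ⟨0, by omega⟩ : Fin a ⊕ Fin b) ≠ Sum.inl ⟨1, by omega⟩ := by simp
  have plusA : ∀ {a b : ℕ} (ha : 2 ≤ a),
      ∀ i ∈ (univ : Finset (Fin a)).map Function.Embedding.inl,
      ∀ j ∈ (univ : Finset (Fin a)).map Function.Embedding.inl, ((bipartitePlus a b).Adj i j ↔
        (i = Sum.inl ⟨0, by omega⟩ ∧ j = Sum.inl ⟨1, by omega⟩) ∨
        (i = Sum.inl ⟨1, by omega⟩ ∧ j = Sum.inl ⟨0, by omega⟩)) := by
    intro a b ha i hi j hj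
    obtain ⟨i, -, rfl⟩ := mem_map.1 hi
    obtain ⟨j, -, rfl⟩ := mem_map.1 hj
    simp only [Function.Embedding.inl_apply, bipartitePlus_adj_inl_inl, Sum.inl.injEq, Fin.ext_iff]
  have minusA : ∀ {a b : ℕ} (ha : 2 ≤ a),
      ∀ i ∈ (univ : Finset (Fin a)).map Function.Embedding.inl,
      ∀ j ∈ (univ : Finset (Fin a)).map Function.Embedding.inl,
        ((bipartitePlusMinus a b).Adj i j ↔
        (i = Sum.inl ⟨0, by omega⟩ ∧ j = Sum.inl ⟨1, by omega⟩) ∨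
        (i = Sum.inl ⟨1, by omega⟩ ∧ j = Sum.inl ⟨0, by omega⟩)) := by
    intro a b ha i hi j hj
    obtain ⟨i, -, rfl⟩ := mem_map.1 hi
    obtain ⟨j, -, rfl⟩ := mem_map.1 hj
    simp only [Function.Embedding.inl_apply, bipartitePlusMinus_adj_inl_inl, Sum.inl.injEq,
      Fin.ext_iff]
  have exR : ∀ {a b : ℕ} {i : Fin a ⊕ Fin b},
      i ∉ (univ : Finset (Fin a)).map Function.Embedding.inl → ∃ j, i = Sum.inr j := by
    intro a b i hi
    rcases i with i | i
    · exact absurd (hmem i) hi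
    · exact ⟨i, rfl⟩
  have plusMain : ∀ p : ℕ, 18 ≤ p → triangleCount (bipartitePlus (p + 1) (p - 1)) = p - 1 ∧
      ENNReal.ofReal (p : ℝ) < adjSpectralRadius (bipartitePlus (p + 1) (p - 1)) := by
    intro p hp
    have h2 : 2 ≤ p + 1 := by omega
    have hB : ∀ i ∉ (univ : Finset (Fin (p + 1))).map Function.Embedding.inl,
        ∀ j ∉ (univ : Finset (Fin (p + 1))).map Function.Embedding.inl,
        ¬ (bipartitePlus (p + 1) (p - 1)).Adj i j := by
      intro i hi j hj
      obtain ⟨i, rfl⟩ := exR hi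
      obtain ⟨j, rfl⟩ := exR hj
      exact bipartitePlus_not_adj_inr_inr i j
    constructor
    · rw [triangleCount_eq_card_common _ ((plusA h2 _ (hmem _) _ (hmem _)).2 (Or.inl ⟨rfl, rfl⟩))
        (plusA h2) hB]
      have : (univ.filter fun z => (bipartitePlus (p + 1) (p - 1)).Adj (Sum.inl ⟨0, by omega⟩) z ∧
          (bipartitePlus (p + 1) (p - 1)).Adj (Sum.inl ⟨1, by omega⟩) z) =
          (univ : Finset (Fin (p - 1))).map Function.Embedding.inr := by
        ext z
        rcases z with z | z
        · refine iff_of_false (fun h => ?_) (by simp)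
          rw [mem_filter, bipartitePlus_adj_inl_inl, bipartitePlus_adj_inl_inl] at h
          obtain ⟨-, h1, h2⟩ := h
          dsimp only at h1 h2
          omega
        · refine iff_of_true ?_ (by simp)
          rw [mem_filter]
          exact ⟨mem_univ _, bipartitePlus_adj_inl_inr _ z, bipartitePlus_adj_inl_inr _ z⟩
      rw [this]
      simp
    · refine lt_adjSpectralRadius_of_plus _ (hmem _) (hmem _) (hne h2) (plusA h2) hB ?_
        (by exact_mod_cast (by omega : 1 < p)) (by rw [hcardA]; push_cast; ring)
        (by rw [hcardB, Nat.cast_sub (by omega)]; simp)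
      intro i hi j hj
      obtain ⟨i, -, rfl⟩ := mem_map.1 hi
      obtain ⟨j, rfl⟩ := exR hj
      exact bipartitePlus_adj_inl_inr i j
  have minusMain : ∀ a b : ℕ, 18 ≤ b → a = b ∨ a = b + 1 →
      triangleCount (bipartitePlusMinus a b) = b - 1 ∧
      ENNReal.ofReal (√((b : ℝ) * a)) < adjSpectralRadius (bipartitePlusMinus a b) := by
    intro a b hb hab
    have h2 : 2 ≤ a := by omega
    have hB : ∀ i ∉ (univ : Finset (Fin a)).map Function.Embedding.inl,
        ∀ j ∉ (univ : Finset (Fin a)).map Function.Embedding.inl,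
        ¬ (bipartitePlusMinus a b).Adj i j := by
      intro i hi j hj
      obtain ⟨i, rfl⟩ := exR hi
      obtain ⟨j, rfl⟩ := exR hj
      exact bipartitePlusMinus_not_adj_inr_inr i j
    constructor
    · rw [triangleCount_eq_card_common _ ((minusA h2 _ (hmem _) _ (hmem _)).2 (Or.inl ⟨rfl, rfl⟩))
        (minusA h2) hB]
      have : (univ.filter fun z => (bipartitePlusMinus a b).Adj (Sum.inl ⟨0, by omega⟩) z ∧
          (bipartitePlusMinus a b).Adj (Sum.inl ⟨1, by omega⟩) z) =
          ((univ : Finset (Fin b)).erase ⟨0, by omega⟩).map Function.Embedding.inr := by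
        ext z
        rcases z with z | z
        · simp [bipartitePlusMinus_adj_inl_inl]
          omega
        · simp [bipartitePlusMinus_adj_inl_inr, Fin.ext_iff]
      rw [this, card_map, card_erase_of_mem (mem_univ _), card_univ, Fintype.card_fin]
    · have hbr : (18 : ℝ) ≤ b := by exact_mod_cast hb
      have har : (a : ℝ) = b ∨ (a : ℝ) = b + 1 := by exact_mod_cast hab
      have hpos : (0 : ℝ) < b * a := by rcases har with h | h <;> rw [h] <;> positivity
      have hsq : (√((b : ℝ) * a)) ^ 2 = b * a := Real.sq_sqrt hpos.le
      refine lt_adjSpectralRadius_of_plusMinus (z := Sum.inr ⟨0, by omega⟩) _ (hmem _) (hmem _)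
        (hne h2) (hnot _) (minusA h2) hB ?_ (Real.sqrt_pos.2 hpos)
        (by rw [hcardA, hcardB, hsq, mul_comm]) ?_
      · intro i hi j hj
        obtain ⟨i, -, rfl⟩ := mem_map.1 hi
        obtain ⟨j, rfl⟩ := exR hj
        simp only [Function.Embedding.inl_apply, bipartitePlusMinus_adj_inl_inr, Sum.inl.injEq,
          Sum.inr.injEq, Fin.ext_iff]
      · rw [hcardB, hsq]
        have hk : √((b : ℝ) * a) ≤ b + 1 / 2 := by
          rw [Real.sqrt_le_left (by linarith)]
          rcases har with h | h <;> rw [h] <;> nlinarith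
        have hk0 : (b : ℝ) ≤ √((b : ℝ) * a) := by
          apply Real.le_sqrt_of_sq_le
          rcases har with h | h <;> rw [h] <;> nlinarith
        rcases har with h | h
        · rw [h] at hk hk0 ⊢
          nlinarith
        -- For a = b + 1 the required inequality reduces to √(ab) > b, so any positive margin
        -- suffices.
        · have hk1 : (b : ℝ) + 1 / 4 ≤ √((b : ℝ) * a) := by
            apply Real.le_sqrt_of_sq_le
            rw [h]
            nlinarith
          rw [h] at hk1 ⊢
          nlinarith
  rcases hG with ⟨⟨p, hp⟩, f | f⟩ | ⟨⟨p, hp⟩, f⟩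
  · have hp2 : n / 2 = p := by omega
    have := plusMain p (by omega)
    rw [hp2] at f
    obtain ⟨f⟩ := f
    rw [triangleCount_iso f, adjSpectralRadius_iso f, hp2,
      adjSpectralRadius_turanGraph_two (h := p) (by omega) (by omega)]
    have e : (p : ℝ) * (n - p) = p ^ 2 := by rw [hp]; push_cast; ring
    rw [e, Real.sqrt_sq (Nat.cast_nonneg _)]
    exact this
  · have hp2 : n / 2 = p := by omega
    have := minusMain p p (by omega) (Or.inl rfl)
    rw [hp2] at f
    obtain ⟨f⟩ := f
    rw [triangleCount_iso f, adjSpectralRadius_iso f, hp2,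
      adjSpectralRadius_turanGraph_two (h := p) (by omega) (by omega)]
    have e : (n : ℝ) - p = p := by rw [hp]; push_cast; ring
    rw [e]
    exact this
  · have hp2 : n / 2 = p := by omega
    have := minusMain (p + 1) p (by omega) (Or.inr rfl)
    rw [show (n + 1) / 2 = p + 1 by omega, show (n - 1) / 2 = p by omega] at f
    obtain ⟨f⟩ := f
    rw [triangleCount_iso f, adjSpectralRadius_iso f, hp2,
      adjSpectralRadius_turanGraph_two (h := p) (by omega) (by omega)]
    have e : (n : ℝ) - p = ((p + 1 : ℕ) : ℝ) := by rw [hp]; push_cast; ring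
    rw [e]
    exact this

end

theorem mainTheorem5 (n : ℕ) (hn : 36 ≤ n) {V : Type*} [Fintype V] [DecidableEq V]
    (hV : Fintype.card V = n) (G : SimpleGraph V) [DecidableRel G.Adj] :
    (adjSpectralRadius (SimpleGraph.turanGraph n 2) ≤ adjSpectralRadius G →
      ¬ Nonempty (G ≃g SimpleGraph.turanGraph n 2) →
      n / 2 - 1 ≤ triangleCount G) ∧
    ((adjSpectralRadius (SimpleGraph.turanGraph n 2) ≤ adjSpectralRadius G ∧
      ¬ Nonempty (G ≃g SimpleGraph.turanGraph n 2) ∧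
      triangleCount G = n / 2 - 1) ↔ IsTriangleExtremal n G) ∧
    ((adjSpectralRadius (SimpleGraph.turanGraph n 2) < adjSpectralRadius G ∧
      triangleCount G = n / 2 - 1) ↔ IsTriangleExtremal n G) := by
  have hconv : IsTriangleExtremal n G → triangleCount G = n / 2 - 1 ∧
      adjSpectralRadius (SimpleGraph.turanGraph n 2) < adjSpectralRadius G :=
    fun h => h.triangleCount_and_lt hn
  have hne : adjSpectralRadius (SimpleGraph.turanGraph n 2) < adjSpectralRadius G →
      ¬ Nonempty (G ≃g SimpleGraph.turanGraph n 2) := by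
    rintro h ⟨f⟩
    exact h.ne (adjSpectralRadius_iso f).symm
  refine ⟨fun hr hiso => ?_, ⟨?_, ?_⟩, ⟨?_, ?_⟩⟩
  -- Fewer than ⌊n/2⌋ - 1 triangles would still make G extremal, but extremal graphs have exactly
  -- that many.
  · by_contra! ht
    have := (hconv (isTriangleExtremal_of_triangleCount_lt G hV hn hr hiso (by omega))).1
    omega
  · rintro ⟨hr, hiso, ht⟩
    exact isTriangleExtremal_of_triangleCount_lt G hV hn hr hiso (by omega)
  · intro h
    obtain ⟨ht, hr⟩ := hconv h
    exact ⟨hr.le, hne hr, ht⟩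
  · rintro ⟨hr, ht⟩
    exact isTriangleExtremal_of_triangleCount_lt G hV hn hr.le (hne hr) (by omega)
  · intro h
    obtain ⟨ht, hr⟩ := hconv h
    exact ⟨hr, ht⟩
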